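/- Let $k$ be an algebraically closed field, $N$ a lattice (a free abelian group of finite rank), $M=\operatorname{Hom}(N,\mathbb Z)$, and $\Delta$ a (finite, nonempty) fan of strongly convex rational polyhedral cones in $N_{\mathbb R}=N\otimes_{\mathbb Z}\mathbb R$. Let $X=X_\Delta$ be the associated toric variety over $k$ with torus $T=\operatorname{Hom}(M,k^*)$, covered by the affine charts $U_\sigma=\operatorname{Spec}k[\sigma_M]$, $\sigma\in\Delta$, where $\sigma_M=\{m\in M\mid \langle m,n\rangle\ge 0 \text{ for all } n\in\sigma\}$. Write $\chi(m)$ for the element of $k[\sigma_M]$ defined by $m\in\sigma_M$, and $m\le_\sigma m'$ if $m'-m\in\sigma_M$. Let $\mathcal E$ be a $T$-equivariant coherent sheaf on $X$, i.e. a coherent sheaf with isomorphisms $\Phi_g:g^*\mathcal E\cong\mathcal E$, $g\in T$, that depend algebraically on $g$ and satisfy $\Phi_{g'g}=\Phi_g\circ g^*\Phi_{g'}$. Here $\Phi_g$ depends algebraically on $g$ if for every $\sigma\in\Delta$ and every $s\in\Gamma(U_\sigma,\mathcal E)$ the orbit map $g\mapsto g.s=\Phi_{g^{-1}}((g^{-1})^*s)$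 is regular, i.e. of the form $g\mapsto\sum_m g(m)f_m$ with finitely many nonzero $f_m\in\Gamma(U_\sigma,\mathcal E)$, $m\in M$. For $\sigma\in\Delta$ and $m\in M$ let $$E^\sigma_m=\{s\in\Gamma(U_\sigma,\mathcal E)\mid g.s=g(m)^{-1}s\ \text{ for all } g\in T\}$$ be the isotypical component of degree $m$. For $m\le_\sigma m'$ let $\chi^\sigma_{m,m'}:E^\sigma_m\to E^\sigma_{m'}$ be multiplication by $\chi(m'-m)$. These data form, for each $\sigma\in\Delta$, a directed family of $k$-vector spaces $\hat E^\sigma$ (together, the $\Delta$-family $\hat E^\Delta$ of $\mathcal E$); let $\mathbf E^\sigma=\varinjlim_m E^\sigma_m$ be its direct limit. Call $\mathcal E$ torsion free if there is an injective homomorphism of $\mathcal O_X$-modules $\mathcal E\to k(X)^r$ for some $r\ge 0$, where $k(X)$ is the constant sheaf of rational functions on $X$. Then the following are equivalent: 1. $\mathcal E$ is torsion free; 2. for every $\sigma\in\Delta$, all maps in the diagrams formed by $\chi^\sigma_{m,m'}:E^\sigma_m\to E^\sigma_{m'}$ and the canonical maps $E^\sigma_m\to\mathbf E^\sigma$, $E^\sigma_{m'}\to\mathbf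 E^\sigma$ ($m\le_\sigma m'$) are injective; 3. for every $\sigma\in\Delta$ and every $m\in M$ the canonical map $E^\sigma_m\to\mathbf E^\sigma$ is injective; 4. for every $\sigma\in\Delta$ and all $m\le_\sigma m'$ the map $\chi^\sigma_{m,m'}$ is injective. -/

import Mathlib

open CategoryTheory CategoryTheory.Limits AlgebraicGeometry TensorProduct

universe u

namespace Toric

noncomputable section

section Cones

variable {N : Type u} [AddCommGroup N]

/-- The `ℝ`-linear extension `⟨m, ·⟩ : N_ℝ = ℝ ⊗ N → ℝ` of a character `m ∈ M = Hom(N, ℤ)`. -/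
def pairing (m : Module.Dual ℤ N) : (ℝ ⊗[ℤ] N) →ₗ[ℝ] ℝ :=
  Module.Dual.baseChange ℝ m

@[simp]
lemma pairing_tmul (m : Module.Dual ℤ N) (r : ℝ) (v : N) :
    pairing m (r ⊗ₜ v) = (m v : ℝ) * r := by
  simp [pairing]

lemma pairing_add (m m' : Module.Dual ℤ N) (x : ℝ ⊗[ℤ] N) :
    pairing (m + m') x = pairing m x + pairing m' x := by
  simp [pairing]

@[simp]
lemma pairing_zero (x : ℝ ⊗[ℤ] N) : pairing (0 : Module.Dual ℤ N) x = 0 := by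
  simp [pairing]

lemma pairing_nsmul (p : ℕ) (m : Module.Dual ℤ N) (x : ℝ ⊗[ℤ] N) :
    pairing (p • m) x = p * pairing m x := by
  induction p with
  | zero => simp
  | succ p ih => rw [succ_nsmul, pairing_add, ih]; push_cast; ring

/-- The semigroup `σ_M` of all `m ∈ M` which are nonnegative on the cone `σ`. -/
def dualMonoid (σ : PointedCone ℝ (ℝ ⊗[ℤ] N)) : AddSubmonoid (Module.Dual ℤ N) where
  carrier := {m | ∀ x ∈ σ, 0 ≤ pairing m x}
  zero_mem' := fun x _ => by simp
  add_mem' := fun ha hb x hx => by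
    rw [pairing_add]; exact add_nonneg (ha x hx) (hb x hx)

lemma dualMonoid_anti {σ τ : PointedCone ℝ (ℝ ⊗[ℤ] N)} (h : τ ≤ σ) :
    dualMonoid σ ≤ dualMonoid τ :=
  fun _ hm x hx => hm x (h hx)

/-- A cone is rational polyhedral if it is generated by finitely many lattice vectors. -/
def IsRationalPolyhedral (σ : PointedCone ℝ (ℝ ⊗[ℤ] N)) : Prop :=
  ∃ s : Finset N, σ = PointedCone.hull ℝ ((fun v : N => (1 : ℝ) ⊗ₜ[ℤ] v) '' (s : Set N))

/-- `τ` is a face of `σ`: it is cut out of `σ` by a supporting hyperplane `m = 0`, `m ∈ σ_M`.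
(For a rational polyhedral cone, real supporting hyperplanes cut out the same faces.) -/
def IsFace (τ σ : PointedCone ℝ (ℝ ⊗[ℤ] N)) : Prop :=
  ∃ m ∈ dualMonoid σ, ∀ x, x ∈ τ ↔ x ∈ σ ∧ pairing m x = 0

lemma exists_add_nsmul_mem {σ τ : PointedCone ℝ (ℝ ⊗[ℤ] N)} (hσ : IsRationalPolyhedral σ)
    {m : Module.Dual ℤ N} (hm : m ∈ dualMonoid σ) (hτ : ∀ x, x ∈ τ ↔ x ∈ σ ∧ pairing m x = 0)
    {m' : Module.Dual ℤ N} (hm' : m' ∈ dualMonoid τ) :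
    ∃ p : ℕ, m' + p • m ∈ dualMonoid σ := by
  obtain ⟨s, rfl⟩ := hσ
  refine ⟨∑ v ∈ s, (m' v).natAbs, fun x hx => ?_⟩
  induction hx using Submodule.span_induction with
  | mem x hx =>
    obtain ⟨v, hv, rfl⟩ := hx
    have hmem : (1 : ℝ) ⊗ₜ[ℤ] v ∈
        PointedCone.hull ℝ ((fun v : N => (1 : ℝ) ⊗ₜ[ℤ] v) '' (s : Set N)) :=
      Submodule.subset_span ⟨v, hv, rfl⟩
    have h0 := hm _ hmem
    rw [pairing_add, pairing_nsmul]
    simp only [pairing_tmul, mul_one] at h0 ⊢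
    have h0' : 0 ≤ m v := by exact_mod_cast h0
    rcases h0'.eq_or_lt with h | h
    · have := hm' ((1 : ℝ) ⊗ₜ[ℤ] v) ((hτ _).2 ⟨hmem, by simp [← h]⟩)
      simp only [pairing_tmul, mul_one] at this
      simpa [← h] using this
    · have h1 : (m' v).natAbs ≤ ∑ v ∈ s, (m' v).natAbs :=
        Finset.single_le_sum (f := fun v => (m' v).natAbs) (fun _ _ => Nat.zero_le _) hv
      have h2 : 0 ≤ m' v + ((∑ v ∈ s, (m' v).natAbs : ℕ) : ℤ) * m v := by
        have : ((∑ v ∈ s, (m' v).natAbs : ℕ) : ℤ) ≤ ((∑ v ∈ s, (m' v).natAbs : ℕ) : ℤ) * m v :=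
          le_mul_of_one_le_right (by positivity) h
        omega
      have h3 := (Int.cast_le (R := ℝ)).2 h2
      rwa [Int.cast_zero, Int.cast_add, Int.cast_mul, Int.cast_natCast] at h3
  | zero => simp
  | add x y _ _ hx hy => rw [map_add]; exact add_nonneg hx hy
  | smul a x _ hx =>
    rw [← Nonneg.coe_smul, map_smul]
    exact mul_nonneg a.2 hx

variable (N) in
/-- A (finite, nonempty) fan of strongly convex rational polyhedral cones in `N_ℝ`. -/
structure Fan where
  cones : Set (PointedCone ℝ (ℝ ⊗[ℤ] N))
  finite : cones.Finite
  nonempty : cones.Nonempty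
  rational : ∀ σ ∈ cones, IsRationalPolyhedral σ
  stronglyConvex : ∀ σ ∈ cones, ∀ x ∈ σ, -x ∈ σ → x = 0
  face_mem : ∀ σ ∈ cones, ∀ τ, IsFace τ σ → τ ∈ cones
  inter_face : ∀ σ ∈ cones, ∀ τ ∈ cones, IsFace (σ ⊓ τ) σ

/-- The cones of a fan, ordered by inclusion: `τ ≤ σ` if and only if `τ` is a face of `σ`. -/
abbrev Fan.Cone (Δ : Fan N) : Type u := Δ.cones

lemma Fan.isFace_of_le (Δ : Fan N) {τ σ : Δ.Cone} (h : τ ≤ σ) : IsFace τ.1 σ.1 := by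
  have := Δ.inter_face σ.1 σ.2 τ.1 τ.2
  rwa [inf_eq_right.2 (show τ.1 ≤ σ.1 from h)] at this

lemma IsFace.le {τ σ : PointedCone ℝ (ℝ ⊗[ℤ] N)} (h : IsFace τ σ) : τ ≤ σ := by
  obtain ⟨m, -, hτ⟩ := h
  exact fun x hx => ((hτ x).1 hx).1

end Cones

section Variety

variable (k : Type u) [Field k] {N : Type u} [AddCommGroup N]

/-- The semigroup ring `k[σ_M]`. -/
abbrev CoordRing (σ : PointedCone ℝ (ℝ ⊗[ℤ] N)) : Type u := AddMonoidAlgebra k (dualMonoid σ)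

/-- The inclusion `k[σ_M] → k[τ_M]` for `τ ⊆ σ`. -/
def resHom {σ τ : PointedCone ℝ (ℝ ⊗[ℤ] N)} (h : τ ≤ σ) : CoordRing k σ →+* CoordRing k τ :=
  AddMonoidAlgebra.mapDomainRingHom k (AddSubmonoid.inclusion (dualMonoid_anti h))

lemma resHom_single {σ τ : PointedCone ℝ (ℝ ⊗[ℤ] N)} (h : τ ≤ σ) (m : dualMonoid σ) (c : k) :
    resHom k h (AddMonoidAlgebra.single m c) =
      AddMonoidAlgebra.single ⟨m.1, dualMonoid_anti h m.2⟩ c := by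
  simp [resHom]; rfl

lemma isLocalization_resHom {σ τ : PointedCone ℝ (ℝ ⊗[ℤ] N)} (hσ : IsRationalPolyhedral σ)
    (h : τ ≤ σ) {m : Module.Dual ℤ N} (hm : m ∈ dualMonoid σ)
    (hτ : ∀ x, x ∈ τ ↔ x ∈ σ ∧ pairing m x = 0) :
    letI := (resHom k h).toAlgebra
    IsLocalization.Away (AddMonoidAlgebra.single (⟨m, hm⟩ : dualMonoid σ) (1 : k) : CoordRing k σ)
      (CoordRing k τ) := by
  let _ := (resHom k h).toAlgebra
  have halg : ∀ a, algebraMap (CoordRing k σ) (CoordRing k τ) a = resHom k h a := fun _ => rfl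
  have hinj : Function.Injective (resHom k h) :=
    AddMonoidAlgebra.mapDomain_injective (AddSubmonoid.inclusion_injective _)
  have hneg : -m ∈ dualMonoid τ := fun x hx => by
    have h1 := pairing_add m (-m) x
    rw [add_neg_cancel, pairing_zero, ((hτ x).1 hx).2] at h1
    linarith
  refine IsLocalization.Away.mk _ ?_ ?_ ?_
  · rw [halg, resHom_single]
    refine IsUnit.of_mul_eq_one (AddMonoidAlgebra.single ⟨-m, hneg⟩ 1) ?_
    rw [AddMonoidAlgebra.single_mul_single, AddMonoidAlgebra.one_def]
    congr 1
    · ext; simp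
    · simp
  · intro a
    induction a using AddMonoidAlgebra.induction_linear with
    | zero => exact ⟨0, 0, by simp⟩
    | add a b ha hb =>
      obtain ⟨n, x, hx⟩ := ha
      obtain ⟨n', y, hy⟩ := hb
      refine ⟨n + n', x * (AddMonoidAlgebra.single (⟨m, hm⟩ : dualMonoid σ) (1 : k)) ^ n' +
        y * (AddMonoidAlgebra.single (⟨m, hm⟩ : dualMonoid σ) (1 : k)) ^ n, ?_⟩
      rw [map_add, map_mul, map_mul, map_pow, map_pow, ← hx, ← hy]
      ring
    | single m' c =>
      obtain ⟨p, hp⟩ := exists_add_nsmul_mem hσ hm hτ m'.2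
      refine ⟨p, AddMonoidAlgebra.single ⟨_, hp⟩ c, ?_⟩
      rw [halg, halg, resHom_single, resHom_single, AddMonoidAlgebra.single_pow,
        AddMonoidAlgebra.single_mul_single]
      congr 1
      simp
  · intro a b hab
    exact ⟨0, by rw [hinj hab]⟩

/-- The diagram `σ ↦ U_σ = Spec k[σ_M]` of affine toric varieties given by a fan. -/
def chartFunctor (Δ : Fan N) : Δ.Cone ⥤ Scheme.{u} where
  obj σ := Spec (CommRingCat.of (CoordRing k σ.1))
  map f := Spec.map (CommRingCat.ofHom (resHom k (leOfHom f)))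
  map_id σ := by
    rw [← Spec.map_id]
    congr 1
    ext : 1
    exact AddMonoidAlgebra.mapDomainRingHom_id (R := k) (M := dualMonoid σ.1)
  map_comp f g := by
    rw [← Spec.map_comp]
    congr 1
    ext : 1
    exact AddMonoidAlgebra.mapDomainRingHom_comp (R := k)
      (AddSubmonoid.inclusion (dualMonoid_anti (leOfHom f)))
      (AddSubmonoid.inclusion (dualMonoid_anti (leOfHom g)))

variable {k}

instance (Δ : Fan N) {τ σ : Δ.Cone} (f : τ ⟶ σ) : IsOpenImmersion ((chartFunctor k Δ).map f) := by
  obtain ⟨m, hm, hτ⟩ := Δ.isFace_of_le (leOfHom f)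
  let _ := (resHom k (leOfHom f)).toAlgebra
  have := isLocalization_resHom k (Δ.rational _ σ.2) (leOfHom f) hm hτ
  exact IsOpenImmersion.of_isLocalization
    (AddMonoidAlgebra.single (⟨m, hm⟩ : dualMonoid σ.1) (1 : k) : CoordRing k σ.1)

lemma range_chartFunctor_map (Δ : Fan N) {τ σ : Δ.Cone} (f : τ ⟶ σ) {m : Module.Dual ℤ N}
    (hm : m ∈ dualMonoid σ.1) (hτ : ∀ x, x ∈ τ.1 ↔ x ∈ σ.1 ∧ pairing m x = 0) :
    Set.range ((chartFunctor k Δ).map f) =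
      (PrimeSpectrum.basicOpen
        (AddMonoidAlgebra.single (⟨m, hm⟩ : dualMonoid σ.1) (1 : k) : CoordRing k σ.1) :
        Set (PrimeSpectrum (CoordRing k σ.1))) := by
  let _ := (resHom k (leOfHom f)).toAlgebra
  have := isLocalization_resHom k (Δ.rational _ σ.2) (leOfHom f) hm hτ
  exact PrimeSpectrum.localization_away_comap_range (CoordRing k τ.1) _

instance (Δ : Fan N) : (chartFunctor k Δ ⋙ Scheme.forget).IsLocallyDirected where
  cond := by
    intro i j l fi fj xi xj h
    obtain ⟨m, hm, hi⟩ := Δ.isFace_of_le (leOfHom fi)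
    obtain ⟨m', hm', hj⟩ := Δ.isFace_of_le (leOfHom fj)
    have hsum : ∀ x, x ∈ i.1 ⊓ j.1 ↔ x ∈ l.1 ∧ pairing (m + m') x = 0 := by
      intro x
      rw [Submodule.mem_inf, hi, hj, pairing_add]
      constructor
      · rintro ⟨⟨h1, h2⟩, -, h3⟩
        exact ⟨h1, by rw [h2, h3, add_zero]⟩
      · rintro ⟨h1, h2⟩
        have := hm x h1
        have := hm' x h1
        exact ⟨⟨h1, by linarith⟩, h1, by linarith⟩
    have hij : i.1 ⊓ j.1 ∈ Δ.cones := Δ.face_mem l.1 l.2 _ ⟨m + m', add_mem hm hm', hsum⟩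
    let q : Δ.Cone := ⟨i.1 ⊓ j.1, hij⟩
    let qi : q ⟶ i := homOfLE (show i.1 ⊓ j.1 ≤ i.1 from inf_le_left)
    let qj : q ⟶ j := homOfLE (show i.1 ⊓ j.1 ≤ j.1 from inf_le_right)
    have hx : (chartFunctor k Δ).map fi xi ∈ Set.range ((chartFunctor k Δ).map (qi ≫ fi)) := by
      rw [range_chartFunctor_map Δ (qi ≫ fi) (add_mem hm hm') hsum]
      have h1 : (chartFunctor k Δ).map fi xi ∈ Set.range ((chartFunctor k Δ).map fi) := ⟨xi, rfl⟩
      have h2 : (chartFunctor k Δ).map fi xi ∈ Set.range ((chartFunctor k Δ).map fj) :=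
        ⟨xj, h.symm⟩
      rw [range_chartFunctor_map Δ fi hm hi] at h1
      rw [range_chartFunctor_map Δ fj hm' hj] at h2
      have h3 : (AddMonoidAlgebra.single (⟨m + m', add_mem hm hm'⟩ : dualMonoid l.1) (1 : k) :
          CoordRing k l.1) = AddMonoidAlgebra.single ⟨m, hm⟩ 1 * AddMonoidAlgebra.single ⟨m', hm'⟩ 1 := by
        rw [AddMonoidAlgebra.single_mul_single, one_mul]; rfl
      rw [h3, PrimeSpectrum.basicOpen_mul]
      exact ⟨h1, h2⟩
    obtain ⟨x, hx⟩ := hx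
    refine ⟨q, qi, qj, x, ?_, ?_⟩
    · apply ((chartFunctor k Δ).map fi).isOpenEmbedding.injective
      rw [← hx, Functor.map_comp]
      rfl
    · apply ((chartFunctor k Δ).map fj).isOpenEmbedding.injective
      refine Eq.trans ?_ (hx.trans h)
      rw [Subsingleton.elim (qi ≫ fi) (qj ≫ fj), Functor.map_comp]
      rfl

variable (k)

/-- The toric variety `X_Δ`, glued from the affine charts `U_σ = Spec k[σ_M]`, `σ ∈ Δ`, along
the open immersions `U_τ → U_σ` for the faces `τ` of `σ`. -/
def toricVariety (Δ : Fan N) : Scheme.{u} := colimit (chartFunctor k Δ)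

/-- The open embedding `U_σ → X_Δ`. -/
abbrev chartι (Δ : Fan N) (σ : Δ.Cone) :
    Spec (CommRingCat.of (CoordRing k σ.1)) ⟶ toricVariety k Δ :=
  colimit.ι (chartFunctor k Δ) σ

instance (Δ : Fan N) (σ : Δ.Cone) : IsOpenImmersion (chartι k Δ σ) :=
  inferInstanceAs (IsOpenImmersion (colimit.ι (chartFunctor k Δ) σ))

/-- The affine open subset `U_σ` of `X_Δ`. -/
abbrev chart (Δ : Fan N) (σ : Δ.Cone) : (toricVariety k Δ).Opens := chartι k Δ σ ''ᵁ ⊤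

lemma chartι_w (Δ : Fan N) {τ σ : Δ.Cone} (f : τ ⟶ σ) :
    (chartFunctor k Δ).map f ≫ chartι k Δ σ = chartι k Δ τ :=
  colimit.w (chartFunctor k Δ) f

lemma toricVariety_hom_ext (Δ : Fan N) {Y : Scheme.{u}} {f g : toricVariety k Δ ⟶ Y}
    (h : ∀ σ, chartι k Δ σ ≫ f = chartι k Δ σ ≫ g) : f = g :=
  colimit.hom_ext h

lemma chartι_mem (Δ : Fan N) (σ : Δ.Cone) (y) : chartι k Δ σ y ∈ chart k Δ σ :=
  ⟨y, trivial, rfl⟩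

/-- The identification `k[σ_M] = Γ(U_σ, 𝒪_X)`. -/
def chartHom (Δ : Fan N) (σ : Δ.Cone) :
    CoordRing k σ.1 →+* Γ(toricVariety k Δ, chart k Δ σ) :=
  ((Scheme.ΓSpecIso (CommRingCat.of (CoordRing k σ.1))).inv ≫
    ((chartι k Δ σ).appIso ⊤).inv).hom

lemma exists_chartι (Δ : Fan N) (x : toricVariety k Δ) : ∃ σ y, chartι k Δ σ y = x :=
  Scheme.IsLocallyDirected.ι_jointly_surjective (chartFunctor k Δ) x

instance (σ : PointedCone ℝ (ℝ ⊗[ℤ] N)) : TwoUniqueSums (dualMonoid σ) :=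
  TwoUniqueSums.of_injective_addHom
    (⟨fun m v => m.1 v, fun _ _ => rfl⟩ : AddHom (dualMonoid σ) (N → ℤ))
    (fun _ _ h => Subtype.ext (LinearMap.ext (congrFun h))) inferInstance

instance (σ : PointedCone ℝ (ℝ ⊗[ℤ] N)) : IsDomain (CoordRing k σ) :=
  NoZeroDivisors.to_isDomain _

instance (Δ : Fan N) : IrreducibleSpace (toricVariety k Δ) where
  isPreirreducible_univ := by
    have key : ∀ (σ : Δ.Cone) (A B : Set (toricVariety k Δ)), IsOpen A → IsOpen B →
        (A ∩ chart k Δ σ).Nonempty → (B ∩ chart k Δ σ).Nonempty →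
        (A ∩ (B ∩ chart k Δ σ)).Nonempty := by
      rintro σ A B hA hB ⟨-, ha, y, -, rfl⟩ ⟨-, hb, z, -, rfl⟩
      have hirr : IrreducibleSpace (Spec (CommRingCat.of (CoordRing k σ.1))) := inferInstance
      obtain ⟨w, hw⟩ := nonempty_preirreducible_inter
        (hA.preimage (chartι k Δ σ).continuous) (hB.preimage (chartι k Δ σ).continuous)
        ⟨y, ha⟩ ⟨z, hb⟩
      exact ⟨_, hw.1, hw.2, chartι_mem k Δ σ w⟩
    have hle : ∀ {τ σ : Δ.Cone}, τ ≤ σ → chart k Δ τ ≤ chart k Δ σ := by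
      rintro τ σ h - ⟨y, -, rfl⟩
      rw [← chartι_w k Δ (homOfLE h)]
      exact chartι_mem k Δ σ _
    have hne : ∀ σ : Δ.Cone, (chart k Δ σ : Set (toricVariety k Δ)).Nonempty := fun σ =>
      ⟨_, chartι_mem k Δ σ (Classical.arbitrary (PrimeSpectrum (CoordRing k σ.1)))⟩
    rintro A B hA hB ⟨a, -, ha⟩ ⟨b, -, hb⟩
    obtain ⟨σ, y, rfl⟩ := exists_chartι k Δ a
    obtain ⟨τ, z, rfl⟩ := exists_chartι k Δ b
    let q : Δ.Cone := ⟨σ.1 ⊓ τ.1,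
      Δ.face_mem _ σ.2 _ (Δ.inter_face _ σ.2 _ τ.2)⟩
    have hqσ : chart k Δ q ≤ chart k Δ σ := hle (show σ.1 ⊓ τ.1 ≤ σ.1 from inf_le_left)
    have hqτ : chart k Δ q ≤ chart k Δ τ := hle (show σ.1 ⊓ τ.1 ≤ τ.1 from inf_le_right)
    obtain ⟨x, hx⟩ := hne q
    obtain ⟨a', ha'⟩ := key σ A (chart k Δ q) hA (chart k Δ q).2 ⟨_, ha, chartι_mem k Δ σ y⟩
      ⟨x, hx, hqσ hx⟩
    obtain ⟨b', hb'⟩ := key τ B (chart k Δ q) hB (chart k Δ q).2 ⟨_, hb, chartι_mem k Δ τ z⟩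
      ⟨x, hx, hqτ hx⟩
    obtain ⟨c, hc⟩ := key q A B hA hB ⟨a', ha'.1, ha'.2.1⟩ ⟨b', hb'.1, hb'.2.1⟩
    exact ⟨c, trivial, hc.1, hc.2.1⟩
  toNonempty := by
    obtain ⟨σ, hσ⟩ := Δ.nonempty
    exact ⟨chartι k Δ ⟨σ, hσ⟩ (Classical.arbitrary (PrimeSpectrum (CoordRing k σ)))⟩

variable (N) in
/-- The group `T = Hom(M, k^*)` of (closed) points of the torus. -/
abbrev Torus : Type u := Multiplicative (Module.Dual ℤ N) →* kˣ

variable {k}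

/-- The value `χ(m)(t) = t(m)` of the character `m` at the point `t` of the torus. -/
def Torus.eval (t : Torus k N) (m : Module.Dual ℤ N) : k := (t (Multiplicative.ofAdd m) : k)

lemma Torus.eval_zero (t : Torus k N) : t.eval 0 = 1 := by
  simp [Torus.eval]

lemma Torus.eval_add (t : Torus k N) (m m' : Module.Dual ℤ N) :
    t.eval (m + m') = t.eval m * t.eval m' := by
  simp [Torus.eval, ofAdd_add]

lemma Torus.eval_mul (t t' : Torus k N) (m : Module.Dual ℤ N) :
    (t * t').eval m = t.eval m * t'.eval m := by
  simp [Torus.eval]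

lemma Torus.eval_inv (t : Torus k N) (m : Module.Dual ℤ N) : t⁻¹.eval m = (t.eval m)⁻¹ := by
  simp [Torus.eval]

/-- The comorphism `χ(m) ↦ t(m) χ(m)` of the multiplication by `t` on `U_σ`. -/
def torusHom (t : Torus k N) (σ : PointedCone ℝ (ℝ ⊗[ℤ] N)) :
    CoordRing k σ →ₐ[k] CoordRing k σ :=
  AddMonoidAlgebra.lift k (CoordRing k σ) (dualMonoid σ)
    { toFun := fun m => AddMonoidAlgebra.single m.toAdd (t.eval m.toAdd.1)
      map_one' := by
        simp [Torus.eval_zero, AddMonoidAlgebra.one_def]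
      map_mul' := fun a b => by
        simp [AddMonoidAlgebra.single_mul_single, Torus.eval_add] }

lemma torusHom_single (t : Torus k N) (σ : PointedCone ℝ (ℝ ⊗[ℤ] N)) (m : dualMonoid σ) (c : k) :
    torusHom t σ (AddMonoidAlgebra.single m c) = AddMonoidAlgebra.single m (c * t.eval m.1) := by
  simp [torusHom]

lemma torusHom_resHom (t : Torus k N) {σ τ : PointedCone ℝ (ℝ ⊗[ℤ] N)} (h : τ ≤ σ)
    (a : CoordRing k σ) : torusHom t τ (resHom k h a) = resHom k h (torusHom t σ a) := by
  induction a using AddMonoidAlgebra.induction_linear with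
  | zero => simp
  | add a b ha hb => simp [ha, hb]
  | single m c => rw [resHom_single, torusHom_single, torusHom_single, resHom_single]

lemma torusHom_mul (t t' : Torus k N) (σ : PointedCone ℝ (ℝ ⊗[ℤ] N)) (a : CoordRing k σ) :
    torusHom (t * t') σ a = torusHom t' σ (torusHom t σ a) := by
  induction a using AddMonoidAlgebra.induction_linear with
  | zero => simp
  | add a b ha hb => simp [ha, hb]
  | single m c =>
    rw [torusHom_single, torusHom_single, torusHom_single, Torus.eval_mul, mul_assoc]

/-- Multiplication by `t` on the affine charts. -/
def chartAction (Δ : Fan N) (t : Torus k N) : chartFunctor k Δ ⟶ chartFunctor k Δ where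
  app σ := Spec.map (CommRingCat.ofHom (torusHom t σ.1).toRingHom)
  naturality τ σ f := by
    refine (Spec.map_comp _ _).symm.trans (Eq.trans ?_ (Spec.map_comp _ _))
    congr 1
    exact CommRingCat.hom_ext (RingHom.ext fun a => (torusHom_resHom t (leOfHom f) a).symm)

/-- The automorphism `x ↦ t . x` of `X_Δ` defined by a point `t` of the torus. -/
def torusAct (Δ : Fan N) (t : Torus k N) : toricVariety k Δ ⟶ toricVariety k Δ :=
  colimMap (chartAction Δ t)

lemma chartι_torusAct (Δ : Fan N) (t : Torus k N) (σ : Δ.Cone) :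
    chartι k Δ σ ≫ torusAct Δ t =
      Spec.map (CommRingCat.ofHom (torusHom t σ.1).toRingHom) ≫ chartι k Δ σ :=
  ι_colimMap (chartAction Δ t) σ

lemma torusAct_mul (Δ : Fan N) (g' g : Torus k N) :
    torusAct Δ g ≫ torusAct Δ g' = torusAct Δ (g' * g) := by
  refine toricVariety_hom_ext k Δ fun σ => ?_
  have h : CommRingCat.ofHom (torusHom (g' * g) σ.1).toRingHom =
      CommRingCat.ofHom (torusHom g' σ.1).toRingHom ≫
        CommRingCat.ofHom (torusHom g σ.1).toRingHom := by
    exact CommRingCat.hom_ext (RingHom.ext fun a => torusHom_mul g' g σ.1 a)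
  rw [chartι_torusAct, ← Category.assoc, chartι_torusAct, Category.assoc, chartι_torusAct, h,
    Spec.map_comp, Category.assoc]

lemma chart_le_preimage (Δ : Fan N) (t : Torus k N) (σ : Δ.Cone) :
    chart k Δ σ ≤ torusAct Δ t ⁻¹ᵁ chart k Δ σ := by
  rintro - ⟨y, -, rfl⟩
  change (chartι k Δ σ ≫ torusAct Δ t) y ∈ chart k Δ σ
  rw [chartι_torusAct]
  exact chartι_mem k Δ σ _

lemma torusAct_appLE_chartHom (Δ : Fan N) (t : Torus k N) (σ : Δ.Cone) (a : CoordRing k σ.1) :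
    (torusAct Δ t).appLE _ _ (chart_le_preimage Δ t σ) (chartHom k Δ σ a) =
      chartHom k Δ σ (torusHom t σ.1 a) := by
  have h : (Scheme.ΓSpecIso (CommRingCat.of (CoordRing k σ.1))).inv ≫
      ((chartι k Δ σ).appIso ⊤).inv ≫ (torusAct Δ t).appLE _ _ (chart_le_preimage Δ t σ) =
      CommRingCat.ofHom (torusHom t σ.1).toRingHom ≫
      (Scheme.ΓSpecIso (CommRingCat.of (CoordRing k σ.1))).inv ≫
      ((chartι k Δ σ).appIso ⊤).inv := by
    rw [← cancel_mono ((chartι k Δ σ).appIso ⊤).hom]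
    simp only [Category.assoc, Iso.inv_hom_id, Category.comp_id]
    rw [Scheme.Hom.appIso_hom', Scheme.Hom.appLE_comp_appLE]
    simp only [chartι_torusAct]
    rw [← Scheme.Hom.appLE_comp_appLE _ _ _ ⊤ ⊤ (by simp) (by simp)]
    rw [← Scheme.Hom.appIso_hom', Iso.inv_hom_id_assoc, Scheme.ΓSpecIso_inv_naturality]
    congr 1
  exact congr($(h) a)

/-- The sections of an `𝒪_X`-module over `U_σ`, considered as a module over `k[σ_M]`. -/
def Sections {Δ : Fan N} (E : (toricVariety k Δ).Modules) (σ : Δ.Cone) : Type u :=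
  Γ(E, chart k Δ σ)

section Sections

variable {Δ : Fan N} (E : (toricVariety k Δ).Modules) (σ : Δ.Cone)

instance : AddCommGroup (Sections E σ) :=
  inferInstanceAs (AddCommGroup Γ(E, chart k Δ σ))

instance : Module Γ(toricVariety k Δ, chart k Δ σ) (Sections E σ) :=
  inferInstanceAs (Module Γ(toricVariety k Δ, chart k Δ σ) Γ(E, chart k Δ σ))

instance : Module (CoordRing k σ.1) (Sections E σ) :=
  Module.compHom _ (chartHom k Δ σ)

instance : Module k (Sections E σ) :=
  Module.compHom _ (algebraMap k (CoordRing k σ.1))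

instance : IsScalarTower k (CoordRing k σ.1) (Sections E σ) :=
  IsScalarTower.of_algebraMap_smul fun _ _ => rfl

lemma coordRing_smul_def (a : CoordRing k σ.1) (s : Sections E σ) :
    a • s = chartHom k Δ σ a • s := rfl

variable {E}

/-- For isomorphisms `Φ_t : t^* E ≅ E` and a section `s` of `E` over `U_σ`, the section
`Φ_t (t^* s)` of `E` over `t⁻¹ U_σ = U_σ`, where `t^* s` is the canonical lift of `s` to a section
of `t^* E`. -/
def translate (Φ : ∀ t : Torus k N, (Scheme.Modules.pullback (torusAct Δ t)).obj E ≅ E)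
    (t : Torus k N) : Sections E σ →+ Sections E σ :=
  (((Scheme.Modules.pullbackPushforwardAdjunction (torusAct Δ t)).unit.app E).app (chart k Δ σ) ≫
    (Φ t).hom.app (torusAct Δ t ⁻¹ᵁ chart k Δ σ) ≫
    E.presheaf.map (homOfLE (chart_le_preimage Δ t σ)).op).hom

/-- The dual action `t . s = Φ_{t⁻¹} ((t⁻¹)^* s)` of the torus on the sections over `U_σ`. -/
def dualAction (Φ : ∀ t : Torus k N, (Scheme.Modules.pullback (torusAct Δ t)).obj E ≅ E)
    (t : Torus k N) : Sections E σ →+ Sections E σ :=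
  translate σ Φ t⁻¹

variable (Φ : ∀ t : Torus k N, (Scheme.Modules.pullback (torusAct Δ t)).obj E ≅ E)

lemma translate_smul (t : Torus k N) (a : CoordRing k σ.1) (s : Sections E σ) :
    translate σ Φ t (a • s) = torusHom t σ.1 a • translate σ Φ t s := by
  rw [coordRing_smul_def, coordRing_smul_def, ← torusAct_appLE_chartHom]
  have h1 := Scheme.Modules.Hom.app_smul
    ((Scheme.Modules.pullbackPushforwardAdjunction (torusAct Δ t)).unit.app E)
    (chartHom k Δ σ a) s
  have h2 := Scheme.Modules.Hom.app_smul (Φ t).hom ((torusAct Δ t).app _ (chartHom k Δ σ a))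
    (((Scheme.Modules.pullbackPushforwardAdjunction (torusAct Δ t)).unit.app E).app
      (chart k Δ σ) s)
  have h3 := Scheme.Modules.map_smul E (homOfLE (chart_le_preimage Δ t σ))
    ((torusAct Δ t).app _ (chartHom k Δ σ a))
    ((Φ t).hom.app (torusAct Δ t ⁻¹ᵁ chart k Δ σ)
    (((Scheme.Modules.pullbackPushforwardAdjunction (torusAct Δ t)).unit.app E).app
      (chart k Δ σ) s))
  refine Eq.trans ?_ h3
  refine congrArg (E.presheaf.map (homOfLE (chart_le_preimage Δ t σ)).op) ?_
  refine Eq.trans ?_ h2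
  exact congrArg ((Φ t).hom.app (torusAct Δ t ⁻¹ᵁ chart k Δ σ)) h1

lemma dualAction_single_smul (t : Torus k N) (m : dualMonoid σ.1) (c : k) (s : Sections E σ) :
    dualAction σ Φ t ((AddMonoidAlgebra.single m c : CoordRing k σ.1) • s) =
      (t.eval m.1)⁻¹ • (AddMonoidAlgebra.single m c : CoordRing k σ.1) • dualAction σ Φ t s := by
  rw [dualAction, translate_smul, torusHom_single, Torus.eval_inv, ← smul_assoc,
    AddMonoidAlgebra.smul_single, smul_eq_mul, mul_comm]

lemma dualAction_smul (t : Torus k N) (c : k) (s : Sections E σ) :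
    dualAction σ Φ t (c • s) = c • dualAction σ Φ t s := by
  have h : ∀ s : Sections E σ,
      c • s = (AddMonoidAlgebra.single (0 : dualMonoid σ.1) c : CoordRing k σ.1) • s :=
    fun _ => rfl
  rw [h, dualAction_single_smul, h]
  simp [Torus.eval_zero]

end Sections

/-- A `T`-linearization of an `𝒪_X`-module `E` on `X = X_Δ`: isomorphisms `Φ_g : g^* E ≅ E` for all
points `g` of the torus `T`, with `Φ_{g'g} = Φ_g ∘ g^* Φ_{g'}` under the identification
`g^* g'^* E = (g'g)^* E`, which depend algebraically on `g`: for each section `s` of `E` over some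
`U_σ`, the orbit map `g ↦ g . s` is a regular function on `T`, that is, it is of the form
`g ↦ ∑ m, χ(m)(g) f_m` for finitely many sections `f_m`. -/
structure Linearization {Δ : Fan N} (E : (toricVariety k Δ).Modules) where
  Φ : ∀ g : Torus k N, (Scheme.Modules.pullback (torusAct Δ g)).obj E ≅ E
  cocycle : ∀ g g' : Torus k N,
    (Scheme.Modules.pullbackComp (torusAct Δ g) (torusAct Δ g')).hom.app E ≫
      (Scheme.Modules.pullbackCongr (torusAct_mul Δ g' g)).hom.app E ≫ (Φ (g' * g)).hom =
    (Scheme.Modules.pullback (torusAct Δ g)).map (Φ g').hom ≫ (Φ g).hom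
  algebraic : ∀ (σ : Δ.Cone) (s : Sections E σ), ∃ f : Module.Dual ℤ N →₀ Sections E σ,
    ∀ g : Torus k N, dualAction σ Φ g s = f.sum fun m e => g.eval m • e

/-- The lattice `M` with the preorder `m ≤_σ m' ↔ m' - m ∈ σ_M`. -/
def Degree (_σ : PointedCone ℝ (ℝ ⊗[ℤ] N)) : Type u := Module.Dual ℤ N

/-- The element of `M` underlying a degree. -/
def Degree.val {σ : PointedCone ℝ (ℝ ⊗[ℤ] N)} (m : Degree σ) : Module.Dual ℤ N := m

instance (σ : PointedCone ℝ (ℝ ⊗[ℤ] N)) : Preorder (Degree σ) where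
  le m m' := m'.val - m.val ∈ dualMonoid σ
  le_refl m := by
    rw [sub_self]; exact zero_mem (dualMonoid σ)
  le_trans a b c hab hbc := by
    have h := add_mem hbc hab
    rwa [sub_add_sub_cancel] at h

variable (k) in
/-- A `σ`-family: vector spaces `E_m`, `m ∈ M`, and compatible linear maps
`χ_{m,m'} : E_m → E_{m'}` for all `m ≤_σ m'`. -/
structure SigmaFamily (σ : PointedCone ℝ (ℝ ⊗[ℤ] N)) where
  V : Degree σ → Type u
  [addCommGroup : ∀ m, AddCommGroup (V m)]
  [module : ∀ m, Module k (V m)]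
  χ : ∀ m m' : Degree σ, m ≤ m' → V m →ₗ[k] V m'
  χ_self : ∀ (m : Degree σ) (e : V m), χ m m le_rfl e = e
  χ_comp : ∀ (m m' m'' : Degree σ) (h : m ≤ m') (h' : m' ≤ m'') (e : V m),
    χ m m'' (h.trans h') e = χ m' m'' h' (χ m m' h e)

attribute [instance] SigmaFamily.addCommGroup SigmaFamily.module

open scoped Classical in
/-- The direct limit of a `σ`-family. -/
def SigmaFamily.Limit {σ : PointedCone ℝ (ℝ ⊗[ℤ] N)} (F : SigmaFamily k σ) : Type u :=
  Module.DirectLimit F.V F.χ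

open scoped Classical in
instance {σ : PointedCone ℝ (ℝ ⊗[ℤ] N)} (F : SigmaFamily k σ) : AddCommGroup F.Limit :=
  inferInstanceAs (AddCommGroup (Module.DirectLimit F.V F.χ))

open scoped Classical in
instance {σ : PointedCone ℝ (ℝ ⊗[ℤ] N)} (F : SigmaFamily k σ) : Module k F.Limit :=
  inferInstanceAs (Module k (Module.DirectLimit F.V F.χ))

open scoped Classical in
/-- The canonical map `E_m → lim E`. -/
def SigmaFamily.toLimit {σ : PointedCone ℝ (ℝ ⊗[ℤ] N)} (F : SigmaFamily k σ) (m : Degree σ) :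
    F.V m →ₗ[k] F.Limit :=
  Module.DirectLimit.of k (Degree σ) F.V F.χ m

namespace Linearization

variable {Δ : Fan N} {E : (toricVariety k Δ).Modules} (L : Linearization E) (σ : Δ.Cone)

/-- The isotypical component `E^σ_m ⊆ Γ(U_σ, E)`, on which `t ∈ T` acts by `t(m)⁻¹`. (With this sign
the function `χ(m)` has degree `m`.) -/
def weightSpace (m : Module.Dual ℤ N) : Submodule k (Sections E σ) where
  carrier := {s | ∀ t : Torus k N, dualAction σ L.Φ t s = (t.eval m)⁻¹ • s}
  zero_mem' := fun t => by rw [map_zero, smul_zero]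
  add_mem' := fun ha hb t => by rw [map_add, ha t, hb t, smul_add]
  smul_mem' := fun c s hs t => by rw [dualAction_smul, hs t, smul_comm]

lemma smul_mem_weightSpace (m : dualMonoid σ.1) (m₁ m₂ : Module.Dual ℤ N) (h : m₁ + m.1 = m₂)
    {s : Sections E σ} (hs : s ∈ L.weightSpace σ m₁) :
    (AddMonoidAlgebra.single m 1 : CoordRing k σ.1) • s ∈ L.weightSpace σ m₂ := by
  intro t
  rw [dualAction_single_smul, hs t, ← h, Torus.eval_add, mul_inv, mul_comm, mul_smul]
  congr 1
  exact smul_comm _ _ _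

/-- The `σ`-family of an equivariant sheaf: its spaces are the isotypical components `E^σ_m` of
`Γ(U_σ, E)`, and `χ_{m,m'}` is the multiplication by the character `χ(m' - m)`. The collection of these
`σ`-families for all cones `σ` of the fan is the `Δ`-family of the sheaf. -/
def sigmaFamily : SigmaFamily k σ.1 where
  V m := L.weightSpace σ m.val
  addCommGroup m := inferInstanceAs (AddCommGroup (L.weightSpace σ m.val))
  module m := inferInstanceAs (Module k (L.weightSpace σ m.val))
  χ m m' h :=
    { toFun := fun e => ⟨(AddMonoidAlgebra.single (⟨m'.val - m.val, h⟩ : dualMonoid σ.1) 1 :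
        CoordRing k σ.1) • e.1,
        L.smul_mem_weightSpace σ ⟨_, h⟩ m.val m'.val (add_sub_cancel m.val m'.val) e.2⟩
      map_add' := fun a b => Subtype.ext (smul_add _ _ _)
      map_smul' := fun c a => Subtype.ext (smul_comm _ c a.1) }
  χ_self m e := by
    have h : (⟨m.val - m.val, le_refl m⟩ : dualMonoid σ.1) = 0 := Subtype.ext (sub_self m.val)
    refine Subtype.ext ?_
    change (AddMonoidAlgebra.single (⟨m.val - m.val, le_refl m⟩ : dualMonoid σ.1) 1 :
      CoordRing k σ.1) • e.1 = e.1
    rw [h, ← AddMonoidAlgebra.one_def, one_smul]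
  χ_comp m m' m'' h h' e := by
    refine Subtype.ext ?_
    change (AddMonoidAlgebra.single (⟨m''.val - m.val, h.trans h'⟩ : dualMonoid σ.1) 1 :
        CoordRing k σ.1) • e.1 =
      (AddMonoidAlgebra.single (⟨m''.val - m'.val, h'⟩ : dualMonoid σ.1) 1 :
        CoordRing k σ.1) •
      (AddMonoidAlgebra.single (⟨m'.val - m.val, h⟩ : dualMonoid σ.1) 1 :
        CoordRing k σ.1) • e.1
    rw [← mul_smul, AddMonoidAlgebra.single_mul_single, one_mul]
    congr 2
    exact Subtype.ext (sub_add_sub_cancel _ _ _).symm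

end Linearization

section TorsionFree

/-- The constant sheaf `k(X)` of rational functions on an irreducible scheme `X`, as an
`𝒪_X`-module: the direct image of the structure sheaf under `Spec k(X) → X`, where `k(X)` is the
stalk of `𝒪_X` at the generic point. -/
def rationalFunctions (X : Scheme.{u}) [IrreducibleSpace X] : X.Modules :=
  (Scheme.Modules.pushforward (X.fromSpecStalk (genericPoint X))).obj
    (SheafOfModules.unit (Spec X.functionField).ringCatSheaf)

/-- A sheaf of modules on an irreducible scheme `X` is torsion free if it embeds into `k(X)^r`
for some `r ≥ 0`. -/
def IsTorsionFree {X : Scheme.{u}} [IrreducibleSpace X] (E : X.Modules) : Prop :=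
  ∃ (r : ℕ) (f : E ⟶ ∏ᶜ fun _ : Fin r => rationalFunctions X), Mono f

/-- Coherence on a Noetherian scheme: `E` is quasi-coherent, and its sections over each affine open
subset form a finitely generated module. -/
structure IsCoherent {X : Scheme.{u}} (E : X.Modules) : Prop where
  isQuasicoherent : SheafOfModules.IsQuasicoherent.{u} E
  finite : ∀ U : X.Opens, IsAffineOpen U → Module.Finite Γ(X, U) Γ(E, U)

end TorsionFree

end Variety

end

end Toric

/-! The heart is the equivalence of 1 and 4; the conditions on direct limits are then formal.
Sections of $k(X)$ over a nonempty open set are cancelled by nonzero functions, so a sheaf embedded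
in $k(X)^r$ admits no section killed by a character. This gives 1 → 4
(`injective_χ_of_isTorsionFree`) and needs neither coherence nor gradings.

For 4 → 1 (`isTorsionFree_of_injective_χ`), the linearization makes $\Gamma(U_\sigma,\mathcal E)$
the sum of its isotypical components (`iSup_weightSpace`), and components of distinct degrees are
independent because distinct characters of $T$ are (`eq_zero_of_sum_eq_zero`). The latter needs
enough points in $T$, hence an infinite field. On the open orbit $U_0$ all characters are units, so
a $k$-basis of the degree-zero part is a $k[M]$-basis of the sections (`exists_basis`), finite by
coherence. Each coordinate form on $\Gamma(U_0,\mathcal E)$ extends to a morphism $\mathcal E\to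
k(X)$ on all of $X$ (`exists_hom_rationalFunctions`).

These morphisms are jointly injective. If all of them kill $s\in\Gamma(U_\sigma,\mathcal E)$, then
$s$ vanishes on $U_0$. Since $U_0$ is the locus in $U_\sigma$ where some $\chi(m)$ is invertible, a
power of $\chi(m)$ kills $s$. By the grading and condition 4 a character acts injectively
(`injective_single_smul`), so $s=0$. Sections over smaller open sets are reduced to this case by
clearing denominators.

For the limits, $E_m\to\mathbf E$ factors through $\chi_{m,m'}$, whence 3 → 4. Strong convexity
makes $\le_\sigma$ directed (`isDirectedOrder_degree`), so an element that dies in the limit already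
dies at a finite stage, whence 4 → 2. -/

namespace Toric

/-! ### Strong convexity: the origin as a face, and directedness of the degrees. -/

section Cones

variable {N : Type u} [AddCommGroup N]

lemma mem_dualMonoid_bot (m : Module.Dual ℤ N) :
    m ∈ dualMonoid (⊥ : PointedCone ℝ (ℝ ⊗[ℤ] N)) := fun x hx => by
  rw [(Submodule.mem_bot _).1 hx, map_zero]

/-- An approximate integral solution of finitely many strict linear inequalities with integral
coefficients is obtained by rounding a multiple of a real solution. -/
lemma exists_int_pos_of_real_pos {ι n : Type*} [Fintype n] (s : Finset ι) (c : ι → n → ℤ)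
    (f : n → ℝ) {δ : ℝ} (hδ : 0 < δ) (h : ∀ i ∈ s, δ < ∑ j, f j * c i j) :
    ∃ g : n → ℤ, ∀ i ∈ s, 0 < ∑ j, g j * c i j := by
  -- Rounding $K f_j$ down costs at most $\sum_j |c_{ij}|$ in the $i$-th inequality; this $K$ makes
  -- the margin $K\delta$ exceed the sum of these costs over all $i$.
  obtain ⟨K, hK⟩ := exists_nat_gt ((∑ i ∈ s, ∑ j, |(c i j : ℝ)|) / δ)
  rw [div_lt_iff₀ hδ] at hK
  refine ⟨fun j => ⌊K * f j⌋, fun i hi => ?_⟩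
  have h1 : ∀ j, K * (f j * c i j) - |(c i j : ℝ)| ≤ (⌊K * f j⌋ : ℝ) * c i j := by
    intro j
    have h2 : (K * f j - ⌊K * f j⌋) * c i j ≤ |(c i j : ℝ)| := by
      refine (le_abs_self _).trans ?_
      rw [abs_mul, abs_of_nonneg (sub_nonneg.2 (Int.floor_le _))]
      exact mul_le_of_le_one_left (abs_nonneg _) (by linarith [Int.lt_floor_add_one (K * f j)])
    nlinarith
  have h3 := Finset.sum_le_sum fun j (_ : j ∈ Finset.univ) => h1 j
  rw [Finset.sum_sub_distrib, ← Finset.mul_sum] at h3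
  have h4 : ∑ j, |(c i j : ℝ)| ≤ ∑ i ∈ s, ∑ j, |(c i j : ℝ)| :=
    Finset.single_le_sum (f := fun i => ∑ j, |(c i j : ℝ)|)
      (fun _ _ => Finset.sum_nonneg fun _ _ => abs_nonneg _) hi
  have h5 : (K : ℝ) * δ ≤ K * ∑ j, f j * c i j :=
    mul_le_mul_of_nonneg_left (h i hi).le (Nat.cast_nonneg K)
  have h6 : (0 : ℝ) < ∑ j, (⌊K * f j⌋ : ℝ) * c i j := by linarith
  exact_mod_cast h6

/-- Hahn–Banach separates the origin from the compact convex hull with a margin $\delta>0$. The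
margin leaves room to round the functional to an integral one in the coordinates of a lattice basis.
-/
lemma exists_dual_pos [Module.Free ℤ N] [Module.Finite ℤ N] (s : Finset N)
    (hs : (0 : ℝ ⊗[ℤ] N) ∉ convexHull ℝ ((fun v : N => (1 : ℝ) ⊗ₜ[ℤ] v) '' (s : Set N))) :
    ∃ m : Module.Dual ℤ N, ∀ v ∈ s, 0 < m v := by
  classical
  let b := Module.Free.chooseBasis ℤ N
  let e := (b.baseChange ℝ).equivFun
  let S : Set (Module.Free.ChooseBasisIndex ℤ N → ℝ) :=
    convexHull ℝ (e '' ((fun v : N => (1 : ℝ) ⊗ₜ[ℤ] v) '' (s : Set N)))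
  have hcomp : IsCompact S :=
    ((s.finite_toSet.image _).image _).isCompact_convexHull ℝ
  have h0 : (0 : Module.Free.ChooseBasisIndex ℤ N → ℝ) ∉ S := by
    intro h
    apply hs
    have h1 : S = e '' convexHull ℝ ((fun v : N => (1 : ℝ) ⊗ₜ[ℤ] v) '' (s : Set N)) :=
      (e.toLinearMap.image_convexHull _).symm
    rw [h1] at h
    obtain ⟨x, hx, hx0⟩ := h
    rwa [e.map_eq_zero_iff.1 hx0] at hx
  obtain ⟨f, δ, hf0, hf⟩ : ∃ (f : StrongDual ℝ (Module.Free.ChooseBasisIndex ℤ N → ℝ)) (δ : ℝ),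
      f 0 < δ ∧ ∀ x ∈ S, δ < f x :=
    geometric_hahn_banach_point_closed (convex_convexHull ℝ _) hcomp.isClosed h0
  rw [map_zero] at hf0
  obtain ⟨g, hg⟩ := exists_int_pos_of_real_pos s (fun v j => b.repr v j)
    (fun j => f (Pi.single j 1)) hf0 fun v hv => by
      have h1 := hf (e ((1 : ℝ) ⊗ₜ[ℤ] v)) (subset_convexHull _ _ ⟨_, ⟨v, hv, rfl⟩, rfl⟩)
      have h2 : e ((1 : ℝ) ⊗ₜ[ℤ] v) = ∑ j, (b.repr v j : ℝ) • Pi.single j (1 : ℝ) := by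
        ext i
        simp [e, Finset.sum_apply, Pi.single_apply]
      rw [h2, map_sum] at h1
      simpa [mul_comm] using h1
  refine ⟨b.constr ℤ g, fun v hv => ?_⟩
  rw [b.constr_apply_fintype ℤ]
  simpa [mul_comm] using hg v hv

/-- The origin is a face of each strongly convex rational polyhedral cone. -/
lemma isFace_bot [Module.Free ℤ N] [Module.Finite ℤ N] {σ : PointedCone ℝ (ℝ ⊗[ℤ] N)}
    (hσ : IsRationalPolyhedral σ) (hconv : ∀ x ∈ σ, -x ∈ σ → x = 0) : IsFace ⊥ σ := by
  classical
  obtain ⟨s, rfl⟩ := hσ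
  -- Zero generators must be discarded, since no functional is positive on them.
  let t := s.filter fun v => (1 : ℝ) ⊗ₜ[ℤ] v ≠ 0
  set σ := PointedCone.hull ℝ ((fun v : N => (1 : ℝ) ⊗ₜ[ℤ] v) '' (s : Set N)) with hσ
  have hmem : ∀ v ∈ s, (1 : ℝ) ⊗ₜ[ℤ] v ∈ σ := fun v hv => Submodule.subset_span ⟨v, hv, rfl⟩
  obtain ⟨m, hm⟩ := exists_dual_pos t (by
    intro h0
    rw [← Finset.coe_image, Finset.convexHull_eq] at h0
    obtain ⟨w, hw0, hw1, hw⟩ := h0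
    rw [Finset.centerMass_eq_of_sum_1 _ _ hw1] at hw
    obtain ⟨x, hx, hwx⟩ : ∃ x ∈ t.image (fun v : N => (1 : ℝ) ⊗ₜ[ℤ] v), 0 < w x := by
      by_contra! h
      have := Finset.sum_nonpos h
      linarith
    have hmem' : ∀ y ∈ t.image (fun v : N => (1 : ℝ) ⊗ₜ[ℤ] v), y ∈ σ ∧ y ≠ 0 := by
      intro y hy
      obtain ⟨v, hv, rfl⟩ := Finset.mem_image.1 hy
      exact ⟨hmem v (Finset.mem_filter.1 hv).1, (Finset.mem_filter.1 hv).2⟩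
    have hsm : ∀ y ∈ t.image (fun v : N => (1 : ℝ) ⊗ₜ[ℤ] v), w y • y ∈ σ := fun y hy =>
      Submodule.smul_mem σ (⟨w y, hw0 y hy⟩ : {r : ℝ // 0 ≤ r}) (hmem' y hy).1
    -- In a convex relation $\sum_y w_y y = 0$, the negative of one summand is the sum of the
    -- others, which lies in the cone; strong convexity then forces $w_x x = 0$.
    have hneg : -(w x • x) ∈ σ := by
      simp only [id_eq] at hw
      rw [← Finset.add_sum_erase _ _ hx] at hw
      rw [neg_eq_of_add_eq_zero_right hw]
      exact σ.sum_mem fun y hy => hsm y (Finset.mem_of_mem_erase hy)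
    exact (hmem' x hx).2
      ((smul_eq_zero.1 (hconv _ (hsm x hx) hneg)).resolve_left hwx.ne'))
  have key : ∀ x ∈ σ, 0 ≤ pairing m x ∧ (pairing m x = 0 → x = 0) := by
    intro x hx
    induction hx using Submodule.span_induction with
    | mem x hx =>
      obtain ⟨v, hv, rfl⟩ := hx
      by_cases h : (1 : ℝ) ⊗ₜ[ℤ] v = 0
      · simp [h]
      · have h1 : (0 : ℝ) < m v := by exact_mod_cast hm v (Finset.mem_filter.2 ⟨hv, h⟩)
        simp only [pairing_tmul, mul_one]
        exact ⟨h1.le, fun h2 => absurd h2 h1.ne'⟩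
    | zero => simp
    | add x y _ _ hx hy =>
      rw [map_add]
      refine ⟨add_nonneg hx.1 hy.1, fun h => ?_⟩
      rw [hx.2 (by linarith [hx.1, hy.1]), hy.2 (by linarith [hx.1, hy.1]), add_zero]
    | smul a x _ hx =>
      rw [← Nonneg.coe_smul, map_smul]
      refine ⟨mul_nonneg a.2 hx.1, fun h => ?_⟩
      rcases smul_eq_zero.1 h with h | h
      · rw [h, zero_smul]
      · rw [hx.2 h, smul_zero]
  refine ⟨m, fun x hx => (key x hx).1, fun x => ⟨fun hx => ?_, fun hx => ?_⟩⟩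
  · rw [(Submodule.mem_bot _).1 hx]
    exact ⟨σ.zero_mem, map_zero _⟩
  · exact (Submodule.mem_bot _).2 ((key x hx.1).2 hx.2)

/-- If $m_0\in\sigma_M$ vanishes on $\sigma$ only at the origin, then every element of $M$ enters
$\sigma_M$ after adding a large multiple of $m_0$. Thus $m + p m_0$ dominates both $m$ and $m'$ for
some $p$. -/
lemma isDirectedOrder_degree {σ : PointedCone ℝ (ℝ ⊗[ℤ] N)} (hσ : IsRationalPolyhedral σ)
    (hface : IsFace ⊥ σ) : IsDirectedOrder (Degree σ) where
  directed m m' := by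
    obtain ⟨m₀, hm₀, h⟩ := hface
    obtain ⟨p, hp⟩ := exists_add_nsmul_mem hσ hm₀ h (mem_dualMonoid_bot (m.val - m'.val))
    refine ⟨(m.val + p • m₀ : Module.Dual ℤ N), ?_, ?_⟩
    · change m.val + p • m₀ - m.val ∈ dualMonoid σ
      rw [add_sub_cancel_left]
      exact nsmul_mem hm₀ p
    · change m.val + p • m₀ - m'.val ∈ dualMonoid σ
      rwa [add_sub_right_comm]

variable [Module.Free ℤ N] [Module.Finite ℤ N]

/-- The cone `{0}` of a fan. -/
def Fan.zeroCone (Δ : Fan N) : Δ.Cone :=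
  ⟨⊥, by
    obtain ⟨σ, hσ⟩ := Δ.nonempty
    exact Δ.face_mem σ hσ _ (isFace_bot (Δ.rational σ hσ) (Δ.stronglyConvex σ hσ))⟩

lemma Fan.isFace_zeroCone (Δ : Fan N) (σ : Δ.Cone) : IsFace Δ.zeroCone.1 σ.1 :=
  isFace_bot (Δ.rational _ σ.2) (Δ.stronglyConvex _ σ.2)

end Cones

/-! ### Direct limits of $\sigma$-families. -/

section Families

variable {k : Type u} [Field k] {N : Type u} [AddCommGroup N] {σ : PointedCone ℝ (ℝ ⊗[ℤ] N)}
  (F : SigmaFamily k σ)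

lemma SigmaFamily.toLimit_χ {m m' : Degree σ} (h : m ≤ m') (e : F.V m) :
    F.toLimit m' (F.χ m m' h e) = F.toLimit m e := by
  classical
  exact Module.DirectLimit.of_f

lemma SigmaFamily.injective_χ_of_injective_toLimit {m m' : Degree σ} (h : m ≤ m')
    (hm : Function.Injective (F.toLimit m)) : Function.Injective (F.χ m m' h) := fun a b hab =>
  hm (by rw [← F.toLimit_χ h, hab, F.toLimit_χ])

lemma SigmaFamily.injective_toLimit [IsDirectedOrder (Degree σ)]
    (hF : ∀ m m' h, Function.Injective (F.χ m m' h)) (m : Degree σ) :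
    Function.Injective (F.toLimit m) := by
  classical
  have : DirectedSystem F.V fun i j h => F.χ i j h :=
    ⟨fun i x => F.χ_self i x, fun _ _ _ h h' x => (F.χ_comp _ _ _ h h' x).symm⟩
  rw [injective_iff_map_eq_zero]
  intro e he
  obtain ⟨m', h, h'⟩ := Module.DirectLimit.of.zero_exact he
  exact (map_eq_zero_iff _ (hF m m' h)).1 h'

end Families

/-! ### Independence of the characters of the torus over an infinite field. -/

section Characters

variable {k : Type u} [Field k] {N : Type u} [AddCommGroup N]

/-- The character `t ↦ t(m)` of the torus. -/
def Torus.character (m : Module.Dual ℤ N) : Torus k N →* k where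
  toFun t := t.eval m
  map_one' := by simp [Torus.eval]
  map_mul' t t' := Torus.eval_mul t t' m

lemma Torus.exists_eval_ne_one [Infinite k] {m : Module.Dual ℤ N} (hm : m ≠ 0) :
    ∃ t : Torus k N, t.eval m ≠ 1 := by
  obtain ⟨v, hv⟩ : ∃ v, m v ≠ 0 := by
    by_contra! h
    exact hm (LinearMap.ext h)
  obtain ⟨x, hx⟩ : ∃ x : kˣ, x ^ m v ≠ 1 := by
    have hn : (m v).natAbs ≠ 0 := Int.natAbs_ne_zero.2 hv
    -- The extra factor $x$ rules out $x=0$ at the same time as $x^n=1$. Over an infinite field the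
    -- polynomials $X^{n+1}$ and $X$ would otherwise coincide.
    obtain ⟨x, hx⟩ : ∃ x : k, x * x ^ (m v).natAbs ≠ x := by
      by_contra! h
      have h1 : (Polynomial.X ^ ((m v).natAbs + 1) : Polynomial k) = Polynomial.X :=
        Polynomial.funext fun x => by simpa [pow_succ'] using h x
      have h2 := congrArg Polynomial.natDegree h1
      simp at h2
      omega
    have hx0 : x ≠ 0 := by rintro rfl; simp at hx
    refine ⟨Units.mk0 x hx0, fun h => hx ?_⟩
    suffices h' : Units.mk0 x hx0 ^ (m v).natAbs = 1 by
      have := congrArg Units.val h'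
      rw [Units.val_pow_eq_pow_val, Units.val_mk0, Units.val_one] at this
      rw [this, mul_one]
    rcases Int.natAbs_eq (m v) with h' | h'
    · rwa [h', zpow_natCast] at h
    · rwa [h', zpow_neg, zpow_natCast, inv_eq_one] at h
  -- The value at $x$ of the one-parameter subgroup of $T$ given by $v\in N$.
  refine ⟨{ toFun := fun m => x ^ m.toAdd v, map_one' := ?_, map_mul' := ?_ }, ?_⟩
  · simp
  · intro a b
    simp [zpow_add]
  · intro h
    exact hx (Units.ext h)

lemma Torus.character_injective [Infinite k] :
    Function.Injective (Torus.character : Module.Dual ℤ N → (Torus k N →* k)) := by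
  intro m m' h
  by_contra hne
  obtain ⟨t, ht⟩ := Torus.exists_eval_ne_one (k := k) (sub_ne_zero.2 hne)
  apply ht
  have h1 : t.eval m = t.eval m' := DFunLike.congr_fun h t
  have h2 := Torus.eval_add t (m - m') m'
  rw [sub_add_cancel, h1] at h2
  exact (mul_eq_right₀ (Units.ne_zero _)).1 h2.symm

/-- Independence of characters, with coefficients in a vector space. -/
lemma Torus.eq_zero_of_sum_eval_smul_eq_zero [Infinite k] {V ι : Type*} [AddCommGroup V]
    [Module k V] {w : ι → Module.Dual ℤ N} (hw : Function.Injective w) (s : Finset ι) (f : ι → V)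
    (h : ∀ t : Torus k N, ∑ i ∈ s, t.eval (w i) • f i = 0) : ∀ i ∈ s, f i = 0 := by
  intro i hi
  rw [← Module.forall_dual_apply_eq_zero_iff k]
  intro ℓ
  have hli := (linearIndependent_monoidHom (Torus k N) k).comp _
    ((Torus.character_injective (N := N)).comp hw)
  rw [linearIndependent_iff'] at hli
  refine hli s (fun i => ℓ (f i)) (funext fun t => ?_) i hi
  have := congrArg ℓ (h t)
  rw [map_sum, map_zero] at this
  rw [Finset.sum_apply, Pi.zero_apply, ← this]
  refine Finset.sum_congr rfl fun i _ => ?_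
  rw [map_smul]
  exact mul_comm _ _

end Characters

/-! ### Pullback–pushforward adjunction and injectivity on sections. -/

section Pullback

variable {X Y Z : Scheme.{u}}

/-- The morphism `E → f_* F` adjoint to a morphism `f^* E → F`. -/
noncomputable def transpose (f : X ⟶ Y) {E : Y.Modules} {F : X.Modules}
    (φ : (Scheme.Modules.pullback f).obj E ⟶ F) : E ⟶ (Scheme.Modules.pushforward f).obj F :=
  (Scheme.Modules.pullbackPushforwardAdjunction f).unit.app E ≫
    (Scheme.Modules.pushforward f).map φ

/-- The comparison isomorphisms for composed pullbacks and composed pushforwards are conjugate, so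
the unit for `f ≫ g` is the composite of the two units; naturality of the unit for `f` moves `φ`
past it. This turns the cocycle condition into a composition law on sections. -/
lemma transpose_comp (f : X ⟶ Y) (g : Y ⟶ Z) {E : Z.Modules} {F : Y.Modules} {G : X.Modules}
    (φ : (Scheme.Modules.pullback g).obj E ⟶ F) (ψ : (Scheme.Modules.pullback f).obj F ⟶ G) :
    transpose (f ≫ g) ((Scheme.Modules.pullbackComp f g).inv.app E ≫
      (Scheme.Modules.pullback f).map φ ≫ ψ) =
    transpose g φ ≫ (Scheme.Modules.pushforward g).map (transpose f ψ) ≫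
      (Scheme.Modules.pushforwardComp f g).hom.app G := by
  have h := unit_conjugateEquiv
    ((Scheme.Modules.pullbackPushforwardAdjunction g).comp
      (Scheme.Modules.pullbackPushforwardAdjunction f))
    (Scheme.Modules.pullbackPushforwardAdjunction (f ≫ g))
    (Scheme.Modules.pullbackComp f g).inv E
  rw [Scheme.Modules.conjugateEquiv_pullbackComp_inv] at h
  have h1 := (Scheme.Modules.pullbackPushforwardAdjunction f).unit.naturality φ
  have h2 := (Scheme.Modules.pushforwardComp f g).hom.naturality
    ((Scheme.Modules.pullback f).map φ ≫ ψ)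
  rw [transpose, Functor.map_comp]
  rw [← Category.assoc, ← h, Category.assoc]
  refine (congrArg (_ ≫ ·) h2.symm).trans ?_
  rw [Adjunction.comp_unit_app]
  simp only [Functor.comp_map, Functor.map_comp, Functor.id_map, transpose, Category.assoc] at h1 ⊢
  rw [← Functor.map_comp_assoc _ _ ((Scheme.Modules.pushforward f).map _), ← h1]
  simp only [Functor.map_comp, Category.assoc]

lemma map_app_map_app (f : X ⟶ Y) (g : Y ⟶ Z) {E : Z.Modules} {F : Y.Modules} {G : X.Modules}
    (α : E ⟶ (Scheme.Modules.pushforward g).obj F) (β : F ⟶ (Scheme.Modules.pushforward f).obj G)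
    {U : Z.Opens} {V : Y.Opens} {W : X.Opens} (hV : V ≤ g ⁻¹ᵁ U) (hW : W ≤ f ⁻¹ᵁ V)
    (hWU : W ≤ (f ≫ g) ⁻¹ᵁ U) (s : Γ(E, U)) :
    G.presheaf.map (homOfLE hW).op (β.app V (F.presheaf.map (homOfLE hV).op (α.app U s))) =
      G.presheaf.map (homOfLE hWU).op ((α ≫ (Scheme.Modules.pushforward g).map β ≫
        (Scheme.Modules.pushforwardComp f g).hom.app G).app U s) := by
  have h := congr($(β.mapPresheaf.naturality (homOfLE hV).op) (α.app U s))
  refine (congrArg (G.presheaf.map (homOfLE hW).op) h).trans ?_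
  exact congr($(G.presheaf.map_comp ((TopologicalSpace.Opens.map f.base).map (homOfLE hV)).op
    (homOfLE hW).op) _).symm

lemma transpose_congr {f g : X ⟶ Y} (h : f = g) {E : Y.Modules} {F : X.Modules}
    (φ : (Scheme.Modules.pullback g).obj E ⟶ F) (U : Y.Opens) (s : Γ(E, U)) :
    (transpose f ((Scheme.Modules.pullbackCongr h).hom.app E ≫ φ)).app U s =
      F.presheaf.map (eqToHom (by rw [h])).op ((transpose g φ).app U s) := by
  subst h
  have : (Scheme.Modules.pullbackCongr (rfl : f = f)).hom.app E = 𝟙 _ := rfl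
  rw [this, Category.id_comp]
  simp

instance (f : X ⟶ Y) [IsIso f] : (Scheme.Modules.pullback f).Faithful := by
  let e : Scheme.Modules.pullback f ⋙ Scheme.Modules.pullback (inv f) ≅ 𝟭 _ :=
    Scheme.Modules.pullbackComp (inv f) f ≪≫
      Scheme.Modules.pullbackCongr (IsIso.inv_hom_id f) ≪≫ Scheme.Modules.pullbackId _
  have : (Scheme.Modules.pullback f ⋙ Scheme.Modules.pullback (inv f)).Faithful :=
    Functor.Faithful.of_iso e.symm
  exact Functor.Faithful.of_comp _ (Scheme.Modules.pullback (inv f))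

lemma injective_app_of_mono {E F : X.Modules} (f : E ⟶ F) [Mono f] (U : X.Opens) :
    Function.Injective (f.app U) := by
  have : PreservesFiniteLimits (Scheme.Modules.toPresheaf X) :=
    PreservesLimits.preservesFiniteLimits _
  have : Mono ((Scheme.Modules.toPresheaf X).map f) := inferInstance
  have : Mono (((Scheme.Modules.toPresheaf X).map f).app (.op U)) := inferInstance
  exact (AddCommGrpCat.mono_iff_injective _).1 this

lemma mono_of_injective_app {E F : X.Modules} (f : E ⟶ F)
    (h : ∀ U, Function.Injective (f.app U)) : Mono f := by
  have : ∀ U, Mono (((Scheme.Modules.toPresheaf X).map f).app U) := fun U =>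
    (AddCommGrpCat.mono_iff_injective _).2 (h U.unop)
  have : Mono ((Scheme.Modules.toPresheaf X).map f) := NatTrans.mono_of_mono_app _
  exact (Scheme.Modules.toPresheaf X).mono_of_mono_map this

/-- Pullback along an isomorphism is faithful, so the unit of the adjunction is a monomorphism;
pushforward, a right adjoint, preserves the monomorphism `φ`. -/
lemma injective_transpose (f : X ⟶ Y) [IsIso f] {E : Y.Modules} {F : X.Modules}
    (φ : (Scheme.Modules.pullback f).obj E ⟶ F) [Mono φ] (U : Y.Opens) :
    Function.Injective ((transpose f φ).app U) := by
  have : Mono (transpose f φ) := by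
    unfold transpose
    infer_instance
  exact injective_app_of_mono _ U

end Pullback

/-! ### The group law for the action of the torus on sections. -/

section Action

variable {k : Type u} [Field k] {N : Type u} [AddCommGroup N] {Δ : Fan N}
  {E : (toricVariety k Δ).Modules}

lemma torusAct_one : torusAct Δ (1 : Torus k N) = 𝟙 _ := by
  refine toricVariety_hom_ext k Δ fun σ => ?_
  have h : CommRingCat.ofHom (torusHom (1 : Torus k N) σ.1).toRingHom = 𝟙 _ := by
    refine CommRingCat.hom_ext (RingHom.ext fun a => ?_)
    change torusHom (1 : Torus k N) σ.1 a = a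
    induction a using AddMonoidAlgebra.induction_linear with
    | zero => simp
    | add a b ha hb => simp [ha, hb]
    | single m c => rw [torusHom_single]; simp [Torus.eval]
  rw [chartι_torusAct, h, Category.comp_id, Spec.map_id]
  exact Category.id_comp _

namespace Linearization

variable (L : Linearization E) (σ : Δ.Cone)

lemma translate_translate (g g' : Torus k N) (s : Sections E σ) :
    translate σ L.Φ g (translate σ L.Φ g' s) = translate σ L.Φ (g' * g) s := by
  have h1 : transpose (torusAct Δ g ≫ torusAct Δ g')
      ((Scheme.Modules.pullbackCongr (torusAct_mul Δ g' g)).hom.app E ≫ (L.Φ (g' * g)).hom) =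
      transpose (torusAct Δ g') (L.Φ g').hom ≫ (Scheme.Modules.pushforward (torusAct Δ g')).map
        (transpose (torusAct Δ g) (L.Φ g).hom) ≫
      (Scheme.Modules.pushforwardComp (torusAct Δ g) (torusAct Δ g')).hom.app E := by
    rw [← transpose_comp, ← L.cocycle, Iso.inv_hom_id_app_assoc]
  have h2 := transpose_congr (torusAct_mul Δ g' g) (L.Φ (g' * g)).hom (chart k Δ σ) s
  rw [h1] at h2
  have hle : chart k Δ σ ≤ (torusAct Δ g ≫ torusAct Δ g') ⁻¹ᵁ chart k Δ σ := by
    rw [torusAct_mul]; exact chart_le_preimage Δ _ σ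
  refine (map_app_map_app (torusAct Δ g) (torusAct Δ g') (transpose (torusAct Δ g') (L.Φ g').hom)
    (transpose (torusAct Δ g) (L.Φ g).hom) (chart_le_preimage Δ g' σ)
    (chart_le_preimage Δ g σ) hle s).trans ?_
  refine (congrArg (E.presheaf.map (homOfLE hle).op) h2).trans ?_
  exact congr($(E.presheaf.map_comp (eqToHom _).op (homOfLE hle).op) _).symm

/-- The unit law is not an axiom of a linearization. By the cocycle condition translation by 1 is
idempotent, and it is injective because $\Phi_1$ is an isomorphism; an injective idempotent map is
the identity. -/
lemma translate_one (s : Sections E σ) : translate σ L.Φ 1 s = s := by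
  have : IsIso (torusAct Δ (1 : Torus k N)) := by
    rw [torusAct_one]
    infer_instance
  have hinj : Function.Injective (translate σ L.Φ 1) := by
    have h0 : torusAct Δ (1 : Torus k N) ⁻¹ᵁ chart k Δ σ = chart k Δ σ := by
      rw [torusAct_one]
      rfl
    have h1 : Function.Injective (E.presheaf.map
        (homOfLE (chart_le_preimage Δ (1 : Torus k N) σ)).op) := by
      have : IsIso (homOfLE (chart_le_preimage Δ (1 : Torus k N) σ)) :=
        ⟨homOfLE h0.le, Subsingleton.elim _ _, Subsingleton.elim _ _⟩
      exact (ConcreteCategory.bijective_of_isIso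
        (E.presheaf.map (homOfLE (chart_le_preimage Δ (1 : Torus k N) σ)).op)).1
    exact h1.comp (injective_transpose _ (L.Φ 1).hom (chart k Δ σ))
  refine hinj ((translate_translate L σ 1 1 s).trans ?_)
  exact congrArg (fun t => translate σ L.Φ t s) (mul_one (1 : Torus k N))

lemma dualAction_one (s : Sections E σ) : dualAction σ L.Φ 1 s = s := by
  exact (congrArg (fun t => translate σ L.Φ t s) inv_one).trans (L.translate_one σ s)

lemma dualAction_dualAction (t t' : Torus k N) (s : Sections E σ) :
    dualAction σ L.Φ t (dualAction σ L.Φ t' s) = dualAction σ L.Φ (t * t') s := by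
  exact (L.translate_translate σ t⁻¹ t'⁻¹ s).trans
    (congrArg (fun t => translate σ L.Φ t s) (mul_inv_rev t t').symm)

end Linearization

end Action

/-! ### The $M$-grading of the sections over a chart. -/

lemma CoordRing.smul_eq_sum {k : Type u} [Field k] {N : Type u} [AddCommGroup N]
    {σ : PointedCone ℝ (ℝ ⊗[ℤ] N)} {V : Type*} [AddCommGroup V] [Module k V]
    [Module (CoordRing k σ) V] [IsScalarTower k (CoordRing k σ) V] (a : CoordRing k σ) (v : V)
    {S : Finset (dualMonoid σ)} (hS : a.coeff.support ⊆ S) :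
    a • v = ∑ m ∈ S, (AddMonoidAlgebra.single m 1 : CoordRing k σ) • a.coeff m • v := by
  conv_lhs => rw [← a.sum_coeff_single]
  rw [Finsupp.sum_of_support_subset _ hS _ (by simp), Finset.sum_smul]
  refine Finset.sum_congr rfl fun m _ => ?_
  rw [smul_comm, ← smul_assoc, AddMonoidAlgebra.smul_single, smul_eq_mul, mul_one]

namespace Linearization

variable {k : Type u} [Field k] {N : Type u} [AddCommGroup N] {Δ : Fan N}
  {E : (toricVariety k Δ).Modules} (L : Linearization E) (σ : Δ.Cone)

lemma eq_zero_of_sum_eq_zero [Infinite k] {ι : Type*} {w : ι → Module.Dual ℤ N}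
    (hw : Function.Injective w) (s : Finset ι) (f : ι → Sections E σ)
    (hf : ∀ i ∈ s, f i ∈ L.weightSpace σ (w i)) (h : ∑ i ∈ s, f i = 0) : ∀ i ∈ s, f i = 0 := by
  refine Torus.eq_zero_of_sum_eval_smul_eq_zero (k := k) hw s f fun t => ?_
  have h1 := congrArg (dualAction σ L.Φ t⁻¹) h
  rw [map_sum, map_zero] at h1
  rw [← h1]
  refine Finset.sum_congr rfl fun i hi => ?_
  rw [hf i hi, Torus.eval_inv, inv_inv]

/-- Write $t'.s=\sum_m t'(m) f_m$. Comparing $t.(t'.s)$ with $(tt').s$ as functions of $t'$,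
independence of characters gives $t.f_m=t(m)f_m$, so $f_m$ has degree $-m$ in the sign convention
used here. At the unit element, $s=\sum_m f_m$. -/
lemma iSup_weightSpace [Infinite k] : ⨆ m, L.weightSpace σ m = ⊤ := by
  refine eq_top_iff.2 fun s _ => ?_
  obtain ⟨f, hf⟩ := L.algebraic σ s
  have hmem : ∀ m ∈ f.support, f m ∈ L.weightSpace σ (-m) := by
    intro m hm t
    have h1 : ∀ t' : Torus k N, ∑ m ∈ f.support,
        t'.eval m • (dualAction σ L.Φ t (f m) - t.eval m • f m) = 0 := by
      intro t'
      have h2 := L.dualAction_dualAction σ t t' s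
      rw [hf, hf, Finsupp.sum, Finsupp.sum, map_sum] at h2
      simp only [smul_sub, Finset.sum_sub_distrib]
      rw [sub_eq_zero]
      refine Eq.trans ?_ (h2.trans ?_)
      · exact Finset.sum_congr rfl fun m _ => (dualAction_smul σ L.Φ t _ _).symm
      · refine Finset.sum_congr rfl fun m _ => ?_
        rw [← mul_smul, Torus.eval_mul, mul_comm]
    have h3 := Torus.eq_zero_of_sum_eval_smul_eq_zero Function.injective_id f.support _ h1 m hm
    rw [sub_eq_zero] at h3
    rw [h3]
    congr 1
    simp [Torus.eval]
  have h4 := hf 1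
  rw [dualAction_one] at h4
  rw [h4]
  refine Submodule.sum_mem _ fun m hm => Submodule.smul_mem _ _ ?_
  exact Submodule.mem_iSup_of_mem (-m) (hmem m hm)

/-- Multiplication by $\chi(m)$ shifts degrees by $m$ and so keeps distinct degrees distinct. If it
kills $s$, it kills every homogeneous component of $s$, where the injectivity of the maps of the
family applies. -/
lemma injective_single_smul [Infinite k] (m : dualMonoid σ.1)
    (h : ∀ m₁ m₂ : Degree σ.1, ∀ h, Function.Injective ((L.sigmaFamily σ).χ m₁ m₂ h))
    {s : Sections E σ} (hs : (AddMonoidAlgebra.single m 1 : CoordRing k σ.1) • s = 0) : s = 0 := by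
  obtain ⟨f, hf, rfl⟩ := (Submodule.mem_iSup_iff_exists_finsupp _ s).1
    (L.iSup_weightSpace σ ▸ Submodule.mem_top : s ∈ ⨆ m, L.weightSpace σ m)
  refine Finset.sum_eq_zero fun m₁ hm₁ => ?_
  rw [Finsupp.sum, Finset.smul_sum] at hs
  have h1 := L.eq_zero_of_sum_eq_zero σ (w := fun m₁ => m₁ + m.1) (add_left_injective _) _ _
    (fun m₁ _ => L.smul_mem_weightSpace σ m m₁ _ rfl (hf m₁)) hs m₁ hm₁
  let d₁ : Degree σ.1 := m₁
  let d₂ : Degree σ.1 := (m₁ + m.1 : Module.Dual ℤ N)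
  have hd : d₂.val - d₁.val = m.1 := add_sub_cancel_left m₁ m.1
  have hle : d₁ ≤ d₂ := by
    change d₂.val - d₁.val ∈ dualMonoid σ.1
    rw [hd]
    exact m.2
  have h2 : (L.sigmaFamily σ).χ d₁ d₂ hle ⟨f m₁, hf m₁⟩ = 0 := by
    refine Subtype.ext ?_
    change (AddMonoidAlgebra.single (⟨d₂.val - d₁.val, hle⟩ : dualMonoid σ.1) 1 :
      CoordRing k σ.1) • f m₁ = 0
    rw [show (⟨d₂.val - d₁.val, hle⟩ : dualMonoid σ.1) = m from Subtype.ext hd]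
    exact h1
  exact congrArg Subtype.val ((map_eq_zero_iff _ (h d₁ d₂ hle)).1 h2)

/-- On the torus, a basis of the space of invariant sections is a basis of the module of all
sections. -/
theorem exists_basis [Infinite k] (L : Linearization E) (hσ : σ.1 = ⊥) :
    ∃ ι : Type u, Nonempty (Module.Basis ι (CoordRing k σ.1) (Sections E σ)) := by
  have hmem : ∀ m, m ∈ dualMonoid σ.1 := fun m => by rw [hσ]; exact mem_dualMonoid_bot m
  let b := Module.Basis.ofVectorSpace k (L.weightSpace σ 0)
  let v : _ → Sections E σ := fun i => (b i).1
  have hli : LinearIndependent (CoordRing k σ.1) v := by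
    classical
    rw [linearIndependent_iff']
    intro s a h
    -- A common finite set of degrees for all coefficients lets the double sum be regrouped by
    -- degree: the part of degree $m$ is $\chi(m)\sum_i (a_i)_m v_i$.
    let S := s.biUnion fun i => (a i).coeff.support
    have hS : ∀ i ∈ s, (a i).coeff.support ⊆ S := fun i hi =>
      Finset.subset_biUnion_of_mem (fun i => (a i).coeff.support) hi
    rw [Finset.sum_congr rfl fun i hi => CoordRing.smul_eq_sum (a i) (v i) (hS i hi),
      Finset.sum_comm] at h
    simp only [← Finset.smul_sum] at h
    have h1 := L.eq_zero_of_sum_eq_zero σ (w := fun m : dualMonoid σ.1 => m.1)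
      Subtype.val_injective S _ (fun m _ => L.smul_mem_weightSpace σ m 0 _ (zero_add _)
        (Submodule.sum_mem _ fun i _ => Submodule.smul_mem _ _ (b i).2)) h
    have h2 : ∀ m ∈ S, ∀ i ∈ s, (a i).coeff m = 0 := by
      intro m hm
      -- On the torus $\chi(m)$ has the inverse $\chi(-m)$; cancelling it leaves a $k$-linear
      -- relation among the vectors of `b`.
      have h3 := congrArg ((AddMonoidAlgebra.single ⟨-m.1, hmem _⟩ 1 : CoordRing k σ.1) • ·)
        (h1 m hm)
      simp only [smul_zero, ← mul_smul, AddMonoidAlgebra.single_mul_single, mul_one] at h3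
      rw [show (⟨-m.1, hmem _⟩ + m : dualMonoid σ.1) = 0 from Subtype.ext (neg_add_cancel m.1),
        ← AddMonoidAlgebra.one_def, one_smul] at h3
      refine linearIndependent_iff'.1 b.linearIndependent s (fun i => (a i).coeff m)
        (Subtype.ext (Eq.trans ?_ h3))
      simp
    intro i hi
    ext m
    by_cases hm : m ∈ S
    · exact h2 m hm i hi
    · exact Finsupp.notMem_support_iff.1 fun h => hm (hS i hi h)
  refine ⟨_, ⟨Module.Basis.mk hli fun s _ => ?_⟩⟩
  have hs : s ∈ ⨆ m, L.weightSpace σ m := L.iSup_weightSpace σ ▸ Submodule.mem_top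
  induction hs using Submodule.iSup_induction' with
  | zero => exact Submodule.zero_mem _
  | add x y _ _ hx hy => exact Submodule.add_mem _ (hx trivial) (hy trivial)
  | mem m x hx =>
    -- Dividing by $\chi(m)$ moves a section of degree $m$ to degree zero, where `b` spans over $k$.
    let y : Sections E σ := (AddMonoidAlgebra.single ⟨-m, hmem _⟩ 1 : CoordRing k σ.1) • x
    have hy : y ∈ L.weightSpace σ 0 :=
      L.smul_mem_weightSpace σ ⟨-m, hmem _⟩ m 0 (add_neg_cancel m) hx
    have hxy : x = (AddMonoidAlgebra.single ⟨m, hmem _⟩ 1 : CoordRing k σ.1) • y := by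
      rw [← mul_smul, AddMonoidAlgebra.single_mul_single, mul_one]
      rw [show (⟨m, hmem _⟩ + ⟨-m, hmem _⟩ : dualMonoid σ.1) = 0 from
        Subtype.ext (add_neg_cancel m), ← AddMonoidAlgebra.one_def, one_smul]
    rw [hxy]
    refine Submodule.smul_mem _ _ ?_
    have h1 : (⟨y, hy⟩ : L.weightSpace σ 0) ∈ Submodule.span k (Set.range b) := by
      rw [b.span_eq]; trivial
    have h2 := Submodule.mem_map_of_mem (f := (L.weightSpace σ 0).subtype) h1
    rw [Submodule.map_span, ← Set.range_comp] at h2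
    exact Submodule.span_le_restrictScalars k (CoordRing k σ.1) _ h2

end Linearization

/-! ### The sheaf $k(X)$, and torsion freeness as joint injectivity of morphisms to it. -/

section RationalFunctions

variable {X : Scheme.{u}}

lemma nonempty_preimage_fromSpecStalk [IrreducibleSpace X] (U : X.Opens) [hU : Nonempty U] :
    Nonempty (X.fromSpecStalk (genericPoint X) ⁻¹ᵁ U) := by
  refine ⟨⟨IsLocalRing.closedPoint _, ?_⟩⟩
  change X.fromSpecStalk (genericPoint X) _ ∈ U
  rw [Scheme.fromSpecStalk_closedPoint]
  exact ((genericPoint_spec X).mem_open_set_iff U.2).2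
    ⟨hU.some.1, trivial, hU.some.2⟩

variable [IsIntegral X]

/-- On an integral scheme taking germs at the generic point is injective, and so is restriction on
$\operatorname{Spec}k(X)$ to the preimage of `U`, which is nonempty. -/
lemma injective_fromSpecStalk_app (U : X.Opens) [Nonempty U] :
    Function.Injective ((X.fromSpecStalk (genericPoint X)).app U) := by
  have hη : genericPoint X ∈ U := by
    have := nonempty_preimage_fromSpecStalk U
    exact ((genericPoint_spec X).mem_open_set_iff U.2).2 ⟨_, trivial, (Classical.arbitrary U).2⟩
  have := nonempty_preimage_fromSpecStalk U
  rw [Scheme.fromSpecStalk_app hη]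
  have h1 : Function.Injective (X.presheaf.germ U (genericPoint X) hη) :=
    X.germToFunctionField_injective U
  have h2 := (ConcreteCategory.bijective_of_isIso
    (Scheme.ΓSpecIso (X.presheaf.stalk (genericPoint X))).inv).1
  have : IsIntegral (Spec (X.presheaf.stalk (genericPoint X))) :=
    inferInstanceAs (IsIntegral (Spec X.functionField))
  have h3 := map_injective_of_isIntegral (Spec (X.presheaf.stalk (genericPoint X)))
    (homOfLE (le_top : X.fromSpecStalk (genericPoint X) ⁻¹ᵁ U ≤ ⊤))
  exact h3.comp (h2.comp h1)

lemma eq_zero_of_smul_eq_zero_rationalFunctions (U : X.Opens) [Nonempty U] {a : Γ(X, U)}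
    (ha : a ≠ 0) {s : Γ(rationalFunctions X, U)} (h : a • s = 0) : s = 0 := by
  have := nonempty_preimage_fromSpecStalk U
  have h1 : (X.fromSpecStalk (genericPoint X)).app U a ≠ 0 := fun h =>
    ha ((map_eq_zero_iff _ (injective_fromSpecStalk_app U)).1 h)
  let s' : Γ(Spec X.functionField, X.fromSpecStalk (genericPoint X) ⁻¹ᵁ U) := s
  have h2 : (X.fromSpecStalk (genericPoint X)).app U a * s' = 0 := h
  exact (mul_eq_zero.1 h2).resolve_left h1

lemma injective_map_rationalFunctions {U V : X.Opens} (h : V ≤ U) [Nonempty V] :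
    Function.Injective ((rationalFunctions X).presheaf.map (homOfLE h).op) := by
  have := nonempty_preimage_fromSpecStalk V
  exact map_injective_of_isIntegral (Spec X.functionField)
    ((TopologicalSpace.Opens.map (X.fromSpecStalk (genericPoint X)).base).map (homOfLE h))

end RationalFunctions

/-- Passing to presheaves and evaluating at `U` both preserve finite products, so sections of a
finite product are determined by their components. -/
lemma app_pi_ext {X : Scheme.{u}} {r : ℕ} (F : Fin r → X.Modules) {U : X.Opens}
    {s : Γ(∏ᶜ F, U)} (h : ∀ i, (Pi.π F i).app U s = 0) : s = 0 := by
  have h1 : PreservesLimitsOfShape (Discrete (Fin r))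
    ((evaluation X.Opensᵒᵖ Ab.{u}).obj (.op U)) := inferInstance
  let G : X.Modules ⥤ Ab := Scheme.Modules.toPresheaf X ⋙ (evaluation X.Opensᵒᵖ Ab.{u}).obj (.op U)
  have : PreservesFiniteLimits (Scheme.Modules.toPresheaf X) :=
    PreservesLimits.preservesFiniteLimits _
  have : PreservesLimitsOfShape (Discrete (Fin r)) G :=
    @comp_preservesLimitsOfShape _ _ _ _ _ _ _ _ _ _ inferInstance h1
  have hlim := isLimitOfPreserves G (limit.isLimit (Discrete.functor F))
  refine Concrete.isLimit_ext _ hlim s 0 fun ⟨i⟩ => ?_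
  exact (h i).trans (map_zero _).symm

lemma isTorsionFree_iff {X : Scheme.{u}} [IrreducibleSpace X] (E : X.Modules) :
    IsTorsionFree E ↔ ∃ (r : ℕ) (f : Fin r → (E ⟶ rationalFunctions X)),
      ∀ (U : X.Opens) (s : Γ(E, U)), (∀ i, (f i).app U s = 0) → s = 0 := by
  constructor
  · rintro ⟨r, f, hf⟩
    refine ⟨r, fun i => f ≫ Pi.π _ i, fun U s hs => ?_⟩
    exact (map_eq_zero_iff _ (injective_app_of_mono f U)).1 (app_pi_ext _ hs)
  · rintro ⟨r, f, hf⟩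
    refine ⟨r, Pi.lift f, mono_of_injective_app _ fun U => ?_⟩
    rw [injective_iff_map_eq_zero]
    intro s hs
    refine hf U s fun i => ?_
    have h1 : f i = Pi.lift f ≫ Pi.π _ i := (Pi.lift_π _ _).symm
    rw [h1, Scheme.Modules.Hom.comp_app, ConcreteCategory.comp_apply, hs, map_zero]

instance {k : Type u} [Field k] {N : Type u} [AddCommGroup N] (Δ : Fan N) :
    IsIntegral (toricVariety k Δ) := by
  have : IsReduced (toricVariety k Δ) := by
    let 𝒰 := Scheme.IsLocallyDirected.openCover (chartFunctor k Δ)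
    have : ∀ i, IsReduced (𝒰.X i) := fun i =>
      inferInstanceAs (IsReduced (Spec (CommRingCat.of (CoordRing k i.1))))
    exact IsReduced.of_openCover _ 𝒰
  exact isIntegral_of_irreducibleSpace_of_isReduced _

/-! ### Quasi-coherent modules on an affine scheme. -/

section Affine

variable {R : CommRingCat.{u}} (M : (Spec R).Modules) [M.IsQuasicoherent]

/-- For quasi-coherent `M` the sections over $D(f)$ are the localization of the global sections at
$f$. -/
lemma exists_pow_smul_eq_zero {f : R} {U : (Spec R).Opens} (hU : U = PrimeSpectrum.basicOpen f)
    {s : Γ(M, ⊤)} (hs : M.presheaf.map U.leTop.op s = 0) : ∃ n : ℕ, f ^ n • s = 0 := by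
  subst hU
  have h : IsLocalizing (modulesSpecToSheaf.obj M) :=
    (isIso_fromTildeΓ_iff_isLocalizing M).1 inferInstance
  have h1 := h f
  obtain ⟨⟨_, n, rfl⟩, hn⟩ := (IsLocalizedModule.eq_zero_iff (.powers f)
    ((modulesSpecToSheaf.obj M).obj.map (PrimeSpectrum.basicOpen f).leTop.op).hom).1 hs
  exact ⟨n, hn⟩

lemma exists_pow_smul_eq_map {f : R} {U : (Spec R).Opens} (hU : U = PrimeSpectrum.basicOpen f)
    (s : Γ(M, U)) : ∃ (n : ℕ) (t : Γ(M, ⊤)), f ^ n • s = M.presheaf.map U.leTop.op t := by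
  subst hU
  have h : IsLocalizing (modulesSpecToSheaf.obj M) :=
    (isIso_fromTildeΓ_iff_isLocalizing M).1 inferInstance
  have h1 := h f
  obtain ⟨⟨t, ⟨_, n, rfl⟩⟩, hn⟩ :=
    h1.surj (show (modulesSpecToSheaf.obj M).obj.obj (.op (PrimeSpectrum.basicOpen f)) from s)
  exact ⟨n, t, hn⟩

/-- A linear form on the global sections of a quasi-coherent module over an affine scheme extends
to a morphism to the structure sheaf. -/
lemma exists_hom_unit (φ : Γ(M, ⊤) →ₗ[R] R) :
    ∃ ψ : M ⟶ SheafOfModules.unit (Spec R).ringCatSheaf,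
      ∀ s : Γ(M, ⊤), ψ.app ⊤ s = 0 → φ s = 0 := by
  let P : ModuleCat R := (modulesSpecToSheaf.obj M).presheaf.obj (.op ⊤)
  let φ' : P ⟶ ModuleCat.of R R := 
    @ModuleCat.ofHom R _ P R P.isAddCommGroup P.isModule _ _ φ
  have hiso : IsIso M.fromTildeΓ := inferInstance
  -- Quasi-coherence identifies `M` with the sheaf associated to its global sections, so the linear
  -- form can be sheafified.
  refine ⟨inv M.fromTildeΓ ≫ tilde.map φ' ≫ tildeSelf.hom, fun s hs => ?_⟩
  let s' : Γ(tilde P, ⊤) := tilde.toOpen P ⊤ s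
  have h1 : M.fromTildeΓ.app ⊤ s' = s := by
    have := congr($(Scheme.Modules.toOpen_fromTildeΓ_app M ⊤) s)
    refine this.trans ?_
    exact congr($((modulesSpecToSheaf.obj M).1.map_id (.op ⊤)) s)
  have h2 : (inv M.fromTildeΓ).app ⊤ s = s' := by
    refine (congrArg ((inv M.fromTildeΓ).app ⊤) h1.symm).trans ?_
    exact congr(($(IsIso.hom_inv_id M.fromTildeΓ)).app ⊤ s')
  have h3 : (tilde.map φ').app ⊤ s' = tilde.toOpen (ModuleCat.of R R) ⊤ (φ s) :=
    congr($(tilde.toOpen_map_app φ' ⊤) s)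
  have h4 : (tilde.map φ').app ⊤ ((inv M.fromTildeΓ).app ⊤ s) = 0 := hs
  rw [h2, h3] at h4
  have h5 := (ConcreteCategory.bijective_of_isIso (tilde.toOpen (ModuleCat.of R R) ⊤)).1
  exact h5 (h4.trans (map_zero _).symm)

end Affine

/-! ### Extending linear forms on an affine open set to morphisms into $k(X)$. -/

lemma injective_pushforwardCongr_app {X Y : Scheme.{u}} {f g : X ⟶ Y} (h : f = g) (M : X.Modules)
    (U : Y.Opens) :
    Function.Injective (((Scheme.Modules.pushforwardCongr h).hom.app M).app U) :=
  (ConcreteCategory.bijective_of_isIso (((Scheme.Modules.pushforwardCongr h).hom.app M).app U)).1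

section RationalFunctions

variable {X : Scheme.{u}} [IsIntegral X] {R : CommRingCat.{u}} [Nontrivial R] (i : Spec R ⟶ X)
  [IsOpenImmersion i] (E : X.Modules) [E.IsQuasicoherent]

/-- The image of $\operatorname{Spec}k(X)\to X$ is the generic point alone, which lies in every
nonempty open set. -/
lemma exists_fac_fromSpecStalk :
    ∃ j : Spec X.functionField ⟶ Spec R, j ≫ i = X.fromSpecStalk (genericPoint X) := by
  refine ⟨IsOpenImmersion.lift i (X.fromSpecStalk (genericPoint X)) ?_,
    IsOpenImmersion.lift_fac _ _ _⟩
  rw [Scheme.range_fromSpecStalk]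
  intro y hy
  have h1 : genericPoint X ∈ i.opensRange :=
    ((genericPoint_spec X).mem_open_set_iff i.opensRange.2).2
      ⟨i (Classical.arbitrary (PrimeSpectrum R)), trivial, ⟨_, rfl⟩⟩
  have h2 : genericPoint X ⤳ y := (genericPoint_spec X).specializes trivial
  rw [show y = genericPoint X from (Specializes.antisymm hy h2).eq]
  exact h1

/-- Since $k(X)$ is pushed forward from the generic point, it is also pushed forward from `Spec R`,
and the form extends to all of `X` without poles to control: $E\to i_*i^*E\to i_*\mathcal O\to
i_*j_*\mathcal O=k(X)$. No information over `Spec R` is lost, as $\mathcal O\to j_*\mathcal O$ is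
injective on the sections concerned. -/
lemma exists_hom_rationalFunctions (φ : Γ(E.restrict i, ⊤) →ₗ[R] R) :
    ∃ θ : E ⟶ rationalFunctions X,
      ∀ s : Γ(E.restrict i, ⊤), θ.app (i ''ᵁ ⊤) s = 0 → φ s = 0 := by
  obtain ⟨j, hj⟩ := exists_fac_fromSpecStalk i
  obtain ⟨ψ, hψ⟩ := exists_hom_unit (E.restrict i) φ
  let u : SheafOfModules.unit (Spec R).ringCatSheaf ⟶
      (Scheme.Modules.pushforward j).obj (SheafOfModules.unit (Spec X.functionField).ringCatSheaf) :=
    SheafOfModules.unitToPushforwardObjUnit j.toRingCatSheafHom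
  let θ : E ⟶ rationalFunctions X := (Scheme.Modules.restrictAdjunction i).unit.app E ≫
    (Scheme.Modules.pushforward i).map (ψ ≫ u) ≫
    (Scheme.Modules.pushforwardComp j i).hom.app _ ≫
    (Scheme.Modules.pushforwardCongr hj).hom.app _
  refine ⟨θ, fun s hs => hψ s ?_⟩
  have : Nonempty (i ''ᵁ ⊤ : X.Opens) :=
    ⟨i (Classical.arbitrary (PrimeSpectrum R)), ⟨_, trivial, rfl⟩⟩
  have hV : i ⁻¹ᵁ i ''ᵁ ⊤ = ⊤ := i.preimage_image_eq ⊤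
  -- The map on functions over the image of `i` is injective for the composite `j ≫ i` and bijective
  -- for `i`.
  have hj_inj : Function.Injective (j.app (i ⁻¹ᵁ i ''ᵁ ⊤)) := by
    have h1 := injective_fromSpecStalk_app (X := X) (i ''ᵁ ⊤)
    rw [← hj, Scheme.Hom.comp_app] at h1
    have h2 := (ConcreteCategory.bijective_of_isIso (i.app (i ''ᵁ ⊤))).2
    exact Function.Injective.of_comp_right h1 h2
  have hres_inj : ∀ F : (Spec R).Modules, Function.Injective
      (F.presheaf.map (homOfLE (le_top : i ⁻¹ᵁ i ''ᵁ ⊤ ≤ ⊤)).op) := by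
    intro F
    have : IsIso (homOfLE (le_top : i ⁻¹ᵁ i ''ᵁ ⊤ ≤ ⊤)) :=
      ⟨homOfLE hV.ge, Subsingleton.elim _ _, Subsingleton.elim _ _⟩
    exact (ConcreteCategory.bijective_of_isIso (F.presheaf.map (homOfLE _).op)).1
  have h1 : (θ.app (i ''ᵁ ⊤)) s = ((Scheme.Modules.pushforwardCongr hj).hom.app _).app (i ''ᵁ ⊤)
      (Scheme.Modules.Hom.app u (i ⁻¹ᵁ i ''ᵁ ⊤) (ψ.app (i ⁻¹ᵁ i ''ᵁ ⊤)
        ((E.restrict i).presheaf.map (homOfLE (le_top : i ⁻¹ᵁ i ''ᵁ ⊤ ≤ ⊤)).op s))) := rfl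
  rw [h1] at hs
  have h2 := injective_pushforwardCongr_app hj
    (SheafOfModules.unit (Spec X.functionField).ringCatSheaf) (i ''ᵁ ⊤)
  have h3 := h2 (hs.trans (map_zero _).symm)
  have h4 := hj_inj (h3.trans (map_zero (j.app (i ⁻¹ᵁ i ''ᵁ ⊤)).hom).symm)
  have h5 := congr($(ψ.mapPresheaf.naturality (homOfLE (le_top : i ⁻¹ᵁ i ''ᵁ ⊤ ≤ ⊤)).op) s)
  exact hres_inj _ ((h5.symm.trans h4).trans (map_zero _).symm)

end RationalFunctions

/-! ### Localization of sections on an affine open subset of a scheme. -/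

section OpenImmersion

variable {X : Scheme.{u}} {R : CommRingCat.{u}} (i : Spec R ⟶ X) [IsOpenImmersion i]
  {E : X.Modules}

/-- The identification of `R` with the functions on the image of an open immersion
`Spec R → X`. -/
noncomputable def specHom : R →+* Γ(X, i ''ᵁ ⊤) :=
  ((Scheme.ΓSpecIso R).inv ≫ (i.appIso ⊤).inv).hom

lemma smul_restrict_top (a : R) (s : Γ(E.restrict i, ⊤)) :
    a • s = (specHom i a • (show Γ(E, i ''ᵁ ⊤) from s) : Γ(E, i ''ᵁ ⊤)) := by
  rw [Scheme.Modules.smul_Spec_def]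
  have h : (Spec R).presheaf.map (TopologicalSpace.Opens.leTop ⊤).op ((Scheme.ΓSpecIso R).inv a) =
      (Scheme.ΓSpecIso R).inv a := congr($((Spec R).presheaf.map_id (.op ⊤)) _)
  rw [h]
  rfl

lemma exists_specHom_pow_smul_eq_zero [E.IsQuasicoherent] {f : R} {V : X.Opens}
    (hV : V = i ''ᵁ PrimeSpectrum.basicOpen f) (hVi : V ≤ i ''ᵁ ⊤) {s : Γ(E, i ''ᵁ ⊤)}
    (hs : E.presheaf.map (homOfLE hVi).op s = 0) : ∃ n : ℕ, specHom i f ^ n • s = 0 := by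
  subst hV
  obtain ⟨n, hn⟩ := exists_pow_smul_eq_zero (E.restrict i) (f := f) rfl (s := s) hs
  refine ⟨n, ?_⟩
  rw [← map_pow]
  exact (smul_restrict_top i (f ^ n) s).symm.trans hn

lemma exists_isUnit_smul_eq_map [E.IsQuasicoherent] (f : R) {V : X.Opens}
    (hV : V = i ''ᵁ PrimeSpectrum.basicOpen f) (hVi : V ≤ i ''ᵁ ⊤) (s : Γ(E, V)) :
    ∃ (c : Γ(X, V)) (t : Γ(E, i ''ᵁ ⊤)), IsUnit c ∧ c • s = E.presheaf.map (homOfLE hVi).op t := by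
  subst hV
  obtain ⟨n, t, h⟩ := exists_pow_smul_eq_map (E.restrict i) (f := f) rfl s
  let D : (Spec R).Opens := PrimeSpectrum.basicOpen f
  -- The unit is the restriction of $f^n$ to $D(f)$, where $f$ is invertible.
  refine ⟨(i.appIso D).inv ((Spec R).presheaf.map D.leTop.op ((Scheme.ΓSpecIso R).inv (f ^ n))),
    t, ?_, h⟩
  refine IsUnit.map _ ?_
  rw [map_pow, map_pow]
  refine IsUnit.pow n ?_
  exact IsLocalization.Away.algebraMap_isUnit f

variable [IsIntegral X] [Nontrivial R]

lemma exists_hom_rationalFunctions_of_linear [E.IsQuasicoherent] (φ : Γ(E, i ''ᵁ ⊤) →+ R)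
    (hφ : ∀ a s, φ (specHom i a • s) = a * φ s) :
    ∃ θ : E ⟶ rationalFunctions X, ∀ s, θ.app (i ''ᵁ ⊤) s = 0 → φ s = 0 :=
  exists_hom_rationalFunctions i E
    { toFun := fun s => φ s
      map_add' := fun s t => φ.map_add s t
      map_smul' := fun a s => by rw [smul_restrict_top]; exact hφ a s }

end OpenImmersion

/-! ### The charts of the toric variety: faces as basic open sets, finiteness of sections. -/

section Charts

variable {k : Type u} [Field k] {N : Type u} [AddCommGroup N] {Δ : Fan N}

lemma bijective_chartHom (σ : Δ.Cone) : Function.Bijective (chartHom k Δ σ) :=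
  ConcreteCategory.bijective_of_isIso
    ((Scheme.ΓSpecIso (CommRingCat.of (CoordRing k σ.1))).inv ≫ ((chartι k Δ σ).appIso ⊤).inv)

variable (k) in
lemma chart_mono {τ σ : Δ.Cone} (h : τ ≤ σ) : chart k Δ τ ≤ chart k Δ σ := by
  rintro - ⟨y, -, rfl⟩
  rw [← chartι_w k Δ (homOfLE h)]
  exact chartι_mem k Δ σ _

variable (k) in
lemma chart_eq_image_basicOpen {τ σ : Δ.Cone} (h : τ ≤ σ) {m : Module.Dual ℤ N}
    (hm : m ∈ dualMonoid σ.1) (hτ : ∀ x, x ∈ τ.1 ↔ x ∈ σ.1 ∧ pairing m x = 0) :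
    chart k Δ τ = chartι k Δ σ ''ᵁ (PrimeSpectrum.basicOpen
      (AddMonoidAlgebra.single (⟨m, hm⟩ : dualMonoid σ.1) (1 : k) : CoordRing k σ.1)) := by
  have h1 := range_chartFunctor_map (k := k) Δ (homOfLE h) hm hτ
  ext x
  constructor
  · rintro ⟨y, -, rfl⟩
    refine ⟨(chartFunctor k Δ).map (homOfLE h) y, ?_, ?_⟩
    · exact h1.le ⟨y, rfl⟩
    · rw [← chartι_w k Δ (homOfLE h)]
      rfl
  · rintro ⟨z, hz, rfl⟩
    obtain ⟨y, rfl⟩ := h1.ge hz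
    refine ⟨y, trivial, ?_⟩
    rw [← chartι_w k Δ (homOfLE h)]
    rfl

variable (E : (toricVariety k Δ).Modules) (σ : Δ.Cone)

lemma finite_sections (hE : IsCoherent E) : Module.Finite (CoordRing k σ.1) (Sections E σ) := by
  let _ : Algebra (CoordRing k σ.1) Γ(toricVariety k Δ, chart k Δ σ) := (chartHom k Δ σ).toAlgebra
  have : IsScalarTower (CoordRing k σ.1) Γ(toricVariety k Δ, chart k Δ σ) (Sections E σ) :=
    IsScalarTower.of_algebraMap_smul fun _ _ => rfl
  have : Module.Finite (CoordRing k σ.1) Γ(toricVariety k Δ, chart k Δ σ) :=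
    Module.Finite.of_surjective (Algebra.linearMap _ _) (bijective_chartHom σ).2
  have : Module.Finite Γ(toricVariety k Δ, chart k Δ σ) (Sections E σ) :=
    hE.finite _ ((isAffineOpen_top _).image_of_isOpenImmersion _)
  exact Module.Finite.trans Γ(toricVariety k Δ, chart k Δ σ) (Sections E σ)

end Charts

/-! ### The two implications between torsion freeness and injectivity of the $\chi_{m,m'}$. -/

section Main

variable {k : Type u} [Field k] {N : Type u} [AddCommGroup N] {Δ : Fan N}
  {E : (toricVariety k Δ).Modules}

theorem injective_χ_of_isTorsionFree (hE : IsTorsionFree E) (L : Linearization E) (σ : Δ.Cone)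
    (m m' : Degree σ.1) (h : m ≤ m') : Function.Injective ((L.sigmaFamily σ).χ m m' h) := by
  obtain ⟨r, f, hf⟩ := (isTorsionFree_iff E).1 hE
  rw [injective_iff_map_eq_zero]
  rintro ⟨s, hs⟩ h0
  let c : CoordRing k σ.1 := AddMonoidAlgebra.single (⟨m'.val - m.val, h⟩ : dualMonoid σ.1) 1
  have h1 : c • s = 0 := congrArg Subtype.val h0
  have hc : c ≠ 0 := by
    intro hc
    simpa [c] using congrArg (fun a => a.coeff ⟨m'.val - m.val, h⟩) hc
  have hne : Nonempty (chart k Δ σ) :=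
    ⟨⟨_, chartι_mem k Δ σ (Classical.arbitrary (PrimeSpectrum (CoordRing k σ.1)))⟩⟩
  refine Subtype.ext (hf (chart k Δ σ) s fun i => ?_)
  refine eq_zero_of_smul_eq_zero_rationalFunctions (chart k Δ σ) (a := chartHom k Δ σ c)
    (fun h => hc ((map_eq_zero_iff _ (bijective_chartHom σ).1).1 h)) ?_
  refine (Scheme.Modules.Hom.app_smul (f i) (chartHom k Δ σ c) s).symm.trans ?_
  exact (congrArg ((f i).app (chart k Δ σ)) h1).trans (map_zero _)

variable [Module.Free ℤ N] [Module.Finite ℤ N]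

theorem isTorsionFree_of_injective_χ [Infinite k] (hE : IsCoherent E) (L : Linearization E)
    (hχ : ∀ (σ : Δ.Cone) (m m') (h : m ≤ m'), Function.Injective ((L.sigmaFamily σ).χ m m' h)) :
    IsTorsionFree E := by
  have := hE.isQuasicoherent
  let o := Δ.zeroCone
  obtain ⟨ι, ⟨b⟩⟩ := Linearization.exists_basis (σ := o) L rfl
  have := finite_sections E o hE
  have : Finite ι := Module.Finite.finite_basis b
  obtain ⟨r, ⟨e⟩⟩ := Finite.exists_equiv_fin ι
  -- The coordinate forms are $k[M]$-linear; `specHom` for this chart is `chartHom` by definition,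
  -- so their linearity is the required one.
  have hθ := fun i : Fin r => exists_hom_rationalFunctions_of_linear (chartι k Δ o) (E := E)
    (b.coord (e.symm i)).toAddMonoidHom (fun a s => (b.coord (e.symm i)).map_smul a s)
  choose θ hθ using hθ
  refine (isTorsionFree_iff E).2 ⟨r, θ, ?_⟩
  have hnat : ∀ i {U V : (toricVariety k Δ).Opens} (h : V ≤ U) (s : Γ(E, U)),
      (θ i).app V (E.presheaf.map (homOfLE h).op s) =
        (rationalFunctions _).presheaf.map (homOfLE h).op ((θ i).app U s) := fun i U V h s =>
    congr($((θ i).mapPresheaf.naturality (homOfLE h).op) s)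
  have hchart : ∀ (σ : Δ.Cone) (s : Sections E σ), (∀ i, (θ i).app (chart k Δ σ) s = 0) →
      s = 0 := by
    intro σ s hs
    have hoσ : o ≤ σ := (Δ.isFace_zeroCone σ).le
    obtain ⟨m, hm, ho⟩ := Δ.isFace_zeroCone σ
    -- Over the torus the morphisms `θ` detect all coordinates in the basis `b`.
    have h1 : E.presheaf.map (homOfLE (chart_mono k hoσ)).op s = 0 := by
      refine b.ext_elem_iff.2 fun j => ?_
      have h2 := hθ (e j) _ (((hnat (e j) (chart_mono k hoσ) s).trans
        (congrArg _ (hs (e j)))).trans (map_zero _))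
      rw [e.symm_apply_apply] at h2
      exact h2.trans (map_zero (b.coord j)).symm
    obtain ⟨n, hn⟩ := exists_specHom_pow_smul_eq_zero (chartι k Δ σ)
      (chart_eq_image_basicOpen k hoσ hm ho) (chart_mono k hoσ) h1
    -- The torus is the basic open set of $\chi(m)$ in $U_\sigma$, and $\chi(m)^n=\chi(nm)$ is again
    -- a character.
    have h3 : (AddMonoidAlgebra.single (⟨m, hm⟩ : dualMonoid σ.1) 1 : CoordRing k σ.1) ^ n • s
        = 0 := by
      rw [coordRing_smul_def, map_pow]
      exact hn
    rw [AddMonoidAlgebra.single_pow, one_pow] at h3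
    exact L.injective_single_smul σ _ (hχ σ) h3
  intro U s hs
  refine TopCat.Presheaf.IsSheaf.section_ext E.isSheaf fun x hx => ?_
  obtain ⟨σ, y, rfl⟩ := exists_chartι k Δ x
  obtain ⟨-, ⟨-, ⟨f, rfl⟩, rfl⟩, hy, hfU⟩ :=
    PrimeSpectrum.isBasis_basic_opens.exists_subset_of_mem_open
      (show y ∈ chartι k Δ σ ⁻¹ᵁ U from hx) (chartι k Δ σ ⁻¹ᵁ U).2
  obtain ⟨V, hV⟩ : ∃ V : (toricVariety k Δ).Opens,
    V = chartι k Δ σ ''ᵁ PrimeSpectrum.basicOpen f := ⟨_, rfl⟩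
  have hyV : chartι k Δ σ y ∈ V := hV ▸ ⟨y, hy, rfl⟩
  have hVU : V ≤ U := by
    rw [hV]
    rintro - ⟨z, hz, rfl⟩
    exact hfU hz
  have hVσ : V ≤ chart k Δ σ := by
    rw [hV]
    rintro - ⟨z, -, rfl⟩
    exact chartι_mem k Δ σ z
  have : Nonempty V := ⟨⟨_, hyV⟩⟩
  refine ⟨V, hVU, hyV, ?_⟩
  -- Up to a unit, the section over the small open set `V` extends to a section `t` over the whole
  -- chart. Its images in $k(X)$ vanish on `V`, hence on the chart, as restriction in $k(X)$ is
  -- injective.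
  obtain ⟨c, t, hc, ht⟩ := exists_isUnit_smul_eq_map (chartι k Δ σ) f hV hVσ
    (E.presheaf.map (homOfLE hVU).op s)
  have ht0 : t = 0 := by
    refine hchart σ t fun i => ?_
    refine (map_eq_zero_iff _ (injective_map_rationalFunctions hVσ)).1 ?_
    rw [← hnat, ← ht, Scheme.Modules.Hom.app_smul, hnat, hs, map_zero, smul_zero]
  rw [ht0, map_zero] at ht
  rw [map_zero]
  exact hc.smul_eq_zero.1 ht

end Main

end Toric

theorem mainTheorem10 {k : Type u} [Field k] [IsAlgClosed k]
    {N : Type u} [AddCommGroup N] [Module.Free ℤ N] [Module.Finite ℤ N]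
    (Δ : Toric.Fan N) (E : (Toric.toricVariety k Δ).Modules)
    (hE : Toric.IsCoherent E) (L : Toric.Linearization E) :
    List.TFAE [
      Toric.IsTorsionFree E,
      ∀ σ : Δ.Cone,
        (∀ m, Function.Injective ((L.sigmaFamily σ).toLimit m)) ∧
        (∀ m m' h, Function.Injective ((L.sigmaFamily σ).χ m m' h)),
      ∀ (σ : Δ.Cone) (m), Function.Injective ((L.sigmaFamily σ).toLimit m),
      ∀ (σ : Δ.Cone) (m m') (h : m ≤ m'),
        Function.Injective ((L.sigmaFamily σ).χ m m' h)] := by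
  tfae_have 1 → 4 := fun h => Toric.injective_χ_of_isTorsionFree h L
  tfae_have 4 → 1 := Toric.isTorsionFree_of_injective_χ hE L
  tfae_have 2 → 3 := fun h σ => (h σ).1
  tfae_have 3 → 4 := fun h σ m _ hm =>
    (L.sigmaFamily σ).injective_χ_of_injective_toLimit hm (h σ _)
  tfae_have 4 → 2 := fun h σ => by
    have := Toric.isDirectedOrder_degree (Δ.rational _ σ.2) (Δ.isFace_zeroCone σ)
    exact ⟨(L.sigmaFamily σ).injective_toLimit (h σ), h σ⟩
  tfae_finish
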